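/- **Setting.** Let $d\in\{2,3\}$ and let $\Omega\subset\mathbb R^d$ be a polytopal domain, i.e. a nonempty connected open set with $\Omega=\operatorname{int}\overline\Omega$ (for instance a polytopal Lipschitz domain) that admits meshes of the following kind. A mesh $\mathcal T_h$ of $\Omega$ is a finite conforming simplicial mesh, the union of whose closed $d$-simplices $K$ is $\overline\Omega$. Let $h_K=\operatorname{diam}K$, $h=\max_K h_K$, $h_{\min}=\min_K h_K$, and let $\mathcal N_h$ be the set of vertices. The mesh is shape-regular with constant $\sigma$ if each $K$ contains a ball of diameter at least $h_K/\sigma$. Let $V_h$ be the space of continuous, $\mathcal T_h$-piecewise affine functions on $\overline\Omega$, $\mathbf V_h=(V_h)^d$, and $I_h$ the nodal interpolation operator onto $V_h$. Let $\Gamma_D\subseteq\partial\Omega$, let $V_{h,D}$ be the space of all $v\in V_h$ with $v(z)=0$ for all $z\in\mathcal N_h\cap\Gamma_D$, and $\mathbf V_{h,D}=(V_{h,D})^d$. For $\mathbf n\in\mathbf V_h$ put $\mathcal T[\mathbf n]=\{\boldsymbol\varphi\in\mathbf V_{h,D}:\mathbf n(z)\cdot\boldsymbol\varphi(z)=0\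 \ \forall z\in\mathcal N_h\}$. Write $(\cdot,\cdot)$ for the $L^2(\Omega)$ inner product. Let $\kappa,\tau_{\mathbf n},\tau_s,\mathrm{tol}>0$. Let $J\subseteq\mathbb R$ be an open interval (e.g. $J=(-1/(d-1),1)$ or $J=\mathbb R$), and let $\psi\in C^2(J)$, $\psi\ge0$, be split as $\psi=\psi_c-\psi_e$ on $J$ with $\psi_c,\psi_e$ convex on $J$ and $\psi_c$ a polynomial of degree at most two. Put $$E_1^h[s,\mathbf n]=\tfrac12\int_\Omega\big(\kappa|\mathbf n\otimes\nabla s|^2+s^2|\nabla\mathbf n|^2\big),\qquad E^h[s,\mathbf n]=E_1^h[s,\mathbf n]+\int_\Omega\psi(s).$$ Let Dirichlet data $g$ (scalar) and $\mathbf r$ (with values in $\mathbb R^d$) be given, with $g>0$ on $\Gamma_D$. **Algorithm**, with a scalar product $(\cdot,\cdot)_*$ on $\mathbf V_{h,D}$ and induced norm $\|\cdot\|_*$. Start from $s_h^0\in V_h$, $\mathbf n_h^0\in\mathbf V_h$ with $|\mathbf n_h^0(z)|=1$ for $z\in\mathcal N_h$, and $\mathbf n_h^0(z)=\mathbf r(z)/g(z)$,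 $s_h^0(z)=g(z)$ for $z\in\mathcal N_h\cap\Gamma_D$. For $i=0,1,\dots$: put $\mathbf n_h^{i,0}=\mathbf n_h^i$; for $\ell=0,1,\dots$ compute $\mathbf t_h^{i,\ell}\in\mathcal T[\mathbf n_h^{i,\ell}]$ such that, for all $\boldsymbol\varphi\in\mathcal T[\mathbf n_h^{i,\ell}]$, $$(\mathbf t_h^{i,\ell},\boldsymbol\varphi)_*+\tau_{\mathbf n}\kappa(\mathbf t_h^{i,\ell}\otimes\nabla s_h^i,\boldsymbol\varphi\otimes\nabla s_h^i)+\tau_{\mathbf n}(s_h^i\nabla\mathbf t_h^{i,\ell},s_h^i\nabla\boldsymbol\varphi)=-\kappa(\mathbf n_h^{i,\ell}\otimes\nabla s_h^i,\boldsymbol\varphi\otimes\nabla s_h^i)-(s_h^i\nabla\mathbf n_h^{i,\ell},s_h^i\nabla\boldsymbol\varphi),$$ and put $\mathbf n_h^{i,\ell+1}=\mathbf n_h^{i,\ell}+\tau_{\mathbf n}\mathbf t_h^{i,\ell}$, until the first $\ell=\ell_i$ with $|E_1^h[s_h^i,\mathbf n_h^{i,\ell+1}]-E_1^h[s_h^i,\mathbf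 n_h^{i,\ell}]|<\mathrm{tol}$; put $\mathbf n_h^{i+1}=\mathbf n_h^{i,\ell_i+1}$. Then compute $s_h^{i+1}\in V_h$ with $s_h^{i+1}(z)=g(z)$ for $z\in\mathcal N_h\cap\Gamma_D$ and, for all $w\in V_{h,D}$, $$\big(\tfrac{s_h^{i+1}-s_h^i}{\tau_s},w\big)+\kappa(\mathbf n_h^{i+1}\otimes\nabla s_h^{i+1},\mathbf n_h^{i+1}\otimes\nabla w)+(s_h^{i+1}\nabla\mathbf n_h^{i+1},w\nabla\mathbf n_h^{i+1})+(\psi_c'(s_h^{i+1}),w)=(\psi_e'(s_h^i),w).$$ All $s_h^i$ are understood to have values in $J$, where $\psi$ is defined (no restriction if $J=\mathbb R$). The two concrete metrics are the $L^2$-metric $(\boldsymbol\varphi,\boldsymbol\chi)_*=(\boldsymbol\varphi,\boldsymbol\chi)$ and the weighted $H^1$-metric $(\boldsymbol\varphi,\boldsymbol\chi)_*=(h^\alpha\nabla\boldsymbol\varphi,\nabla\boldsymbol\chi)$ with $0<\alpha\le2$. **Proposition.** Let $\mathcal T_h$ be shape-regular with constant $\sigma$ and let $j\ge1$. Then every pair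 $(s_h^j,\mathbf n_h^j)$ produced by $j$ outer iterations of the algorithm satisfies the following. (i) If $\|\boldsymbol\varphi\|_{L^2(\Omega)}\le C_*\|\boldsymbol\varphi\|_*$ for all $\boldsymbol\varphi\in\mathbf V_{h,D}$, with $C_*>0$, then $$\big\|I_h\big[|\mathbf n_h^j|^2-1\big]\big\|_{L^1(\Omega)}\le C_1\,\tau_{\mathbf n}\,E^h[s_h^0,\mathbf n_h^0],$$ where $C_1>0$ depends only on $d$, $C_*$ and $\sigma$ (in particular not on $j$ or on the numbers $\ell_i$ of inner iterations). (ii) Let $C^*>0$ be arbitrary. If the $L^2$-metric is used and $\tau_{\mathbf n}h_{\min}^{-d}\le C^*$, then $$\|\mathbf n_h^j\|_{L^\infty(\Omega)}\le1+C_2\,E^h[s_h^0,\mathbf n_h^0],\qquad C_2=c\,C^*,$$ where $c>0$ depends only on $d$ and $\sigma$. If the weighted $H^1$-metric is used, $\mathcal N_h\cap\Gamma_D\ne\emptyset$, $h_{\min}\le h_0$ for some $h_0\in(0,1)$, and $\tau_{\mathbf n}h_{\min}^{2-d-\alpha}|\log h_{\min}|^2\le C^*$, then the same bound holds with $C_2=c\,C^*$,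 where $c>0$ depends only on $\Omega$ (hence $d$), $\sigma$ and $h_0$. -/

import Mathlib

open MeasureTheory

namespace Ericksen

noncomputable section

/-- The Euclidean space `ℝ^d`. -/
abbrev E (d : ℕ) : Type := EuclideanSpace ℝ (Fin d)

/-- A domain that equals the interior of its closure: a nonempty connected open set (as every
Lipschitz domain is).  It is bounded and polytopal as soon as it carries a `Mesh`. -/
structure IsPlainDomain {d : ℕ} (Ω : Set (E d)) : Prop where
  isOpen : IsOpen Ω
  isConnected : IsConnected Ω
  interior_closure : interior (closure Ω) = Ω

/-- A conforming simplicial mesh of `Ω`: a finite simplicial complex whose maximal faces (the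
elements) are `d`-simplices and whose union is the closure of `Ω`.  An element is represented by
the finite set of its `d + 1` vertices. -/
structure Mesh {d : ℕ} (Ω : Set (E d)) extends Geometry.SimplicialComplex ℝ (E d) where
  finite_faces : faces.Finite
  card_facet : ∀ K ∈ toSimplicialComplex.facets, K.card = d + 1
  space_eq : toSimplicialComplex.space = closure Ω

namespace Mesh

variable {d : ℕ} {Ω : Set (E d)} (T : Mesh Ω)

/-- The elements of the mesh. -/
def elements : Set (Finset (E d)) := T.toSimplicialComplex.facets

/-- The set of vertices of the mesh. -/
def nodes : Set (E d) := T.toSimplicialComplex.vertices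

/-- The closed simplex spanned by `K`. -/
def cell (K : Finset (E d)) : Set (E d) := convexHull ℝ (K : Set (E d))

/-- The diameter `h_K` of an element. -/
def diamOf (K : Finset (E d)) : ℝ := Metric.diam (cell K)

/-- The mesh size `h = max_K h_K`. -/
def hMax : ℝ := sSup (diamOf '' T.elements)

/-- The minimal element size `h_min = min_K h_K`. -/
def hMin : ℝ := sInf (diamOf '' T.elements)

/-- Shape regularity with constant `σ`: every element `K` contains a closed ball whose diameter is
at least `h_K / σ`.  A family of meshes is shape-regular if one `σ` serves for all its members. -/
def ShapeRegular (σ : ℝ) : Prop :=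
  ∀ K ∈ T.elements, ∃ (c : E d) (r : ℝ), 0 < r ∧ Metric.closedBall c r ⊆ cell K ∧
    diamOf K ≤ σ * (2 * r)

/-- `V_h`: continuous functions on the closure of `Ω` that are affine on each element.  (Only the
values on the closure of `Ω` matter.) -/
def Vh : Set (E d → ℝ) :=
  {v | ContinuousOn v (closure Ω) ∧
    ∀ K ∈ T.elements, ∃ A : E d →ᵃ[ℝ] ℝ, Set.EqOn v A (cell K)}

/-- `𝐕_h = (V_h)^d`. -/
def VVh : Set (E d → E d) := {φ | ∀ i, (fun x => φ x i) ∈ T.Vh}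

/-- `V_{h,D}`: functions of `V_h` vanishing at all nodes on `Γ`. -/
def VhD (Γ : Set (E d)) : Set (E d → ℝ) := {v | v ∈ T.Vh ∧ ∀ z ∈ T.nodes ∩ Γ, v z = 0}

/-- `𝐕_{h,D} = (V_{h,D})^d`. -/
def VVhD (Γ : Set (E d)) : Set (E d → E d) := {φ | ∀ i, (fun x => φ x i) ∈ T.VhD Γ}

/-- The space of tangential fields: the functions of `𝐕_{h,D}` whose nodal values are orthogonal
to those of `n`. -/
def tangent (Γ : Set (E d)) (n : E d → E d) : Set (E d → E d) :=
  {φ | φ ∈ T.VVhD Γ ∧ ∀ z ∈ T.nodes, inner ℝ (n z) (φ z) = 0}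

theorem exists_element {x : E d} (hx : x ∈ closure Ω) : ∃ K ∈ T.elements, x ∈ cell K := by
  rw [← T.space_eq, Geometry.SimplicialComplex.mem_space_iff] at hx
  obtain ⟨s, hs, hx⟩ := hx
  obtain ⟨K, hsK, hK⟩ := T.finite_faces.exists_le_maximal hs
  refine ⟨K, ⟨hK.1, fun t ht hKt => le_antisymm hKt (hK.2 ht hKt)⟩, ?_⟩
  exact convexHull_mono (Finset.coe_subset.2 hsK) hx

theorem exists_affineMap (f : E d → ℝ) {K : Finset (E d)} (hK : K ∈ T.elements) :
    ∃ A : E d →ᵃ[ℝ] ℝ, ∀ z ∈ K, A z = f z := by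
  classical
  have ind := T.indep hK.1
  have htop := (ind.affineSpan_eq_top_iff_card_eq_finrank_add_one).2
    (by simp [T.card_facet K hK])
  let b : AffineBasis K ℝ (E d) := ⟨_, ind, htop⟩
  refine ⟨∑ i : K, f i • b.coord i, fun z hz => ?_⟩
  have hb : z = b ⟨z, hz⟩ := rfl
  have key : ∀ S : Finset K,
      (∑ i ∈ S, f i • b.coord i : E d →ᵃ[ℝ] ℝ) z = ∑ i ∈ S, f i * b.coord i z := by
    intro S
    induction S using Finset.induction_on with
    | empty => simp
    | insert a S ha ih => simp [Finset.sum_insert ha, ih]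
  rw [key, hb]
  simp only [AffineBasis.coord_apply]
  simp
  rfl

/-- Existence of the nodal interpolant. -/
theorem exists_interpolant (f : E d → ℝ) : ∃ v ∈ T.Vh, ∀ z ∈ T.nodes, v z = f z := by
  classical
  have hA : ∀ K : Finset (E d), ∃ A : E d →ᵃ[ℝ] ℝ, K ∈ T.elements → ∀ z ∈ K, A z = f z := by
    intro K
    by_cases hK : K ∈ T.elements
    · obtain ⟨A, h⟩ := T.exists_affineMap f hK
      exact ⟨A, fun _ => h⟩
    · exact ⟨0, fun h => absurd h hK⟩
  choose A hA using hA
  have hk : ∀ x : E d, ∃ K : Finset (E d), x ∈ closure Ω → K ∈ T.elements ∧ x ∈ cell K := by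
    intro x
    by_cases hx : x ∈ closure Ω
    · obtain ⟨K, h⟩ := T.exists_element hx
      exact ⟨K, fun _ => h⟩
    · exact ⟨∅, fun h => absurd h hx⟩
  choose k hk using hk
  have hsub : ∀ K ∈ T.elements, cell K ⊆ closure Ω := fun K hK => by
    rw [← T.space_eq]
    exact Geometry.SimplicialComplex.convexHull_subset_space hK.1
  have hEq : ∀ K ∈ T.elements, Set.EqOn (fun x => A (k x) x) (A K) (cell K) := by
    intro K hK x hx
    obtain ⟨hk1, hk2⟩ := hk x (hsub K hK hx)
    have hx' := T.inter_subset_convexHull hk1.1 hK.1 ⟨hk2, hx⟩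
    have hconv : Convex ℝ {y | A (k x) y = A K y} := by
      intro y hy w hw a b ha hb hab
      simp only [Set.mem_ofPred_eq] at *
      rw [Convex.combo_affine_apply hab, Convex.combo_affine_apply hab, hy, hw]
    refine convexHull_min ?_ hconv hx'
    rintro z ⟨hz1, hz2⟩
    simp only [Set.mem_ofPred_eq]
    rw [hA _ hk1 z hz1, hA _ hK z hz2]
  refine ⟨fun x => A (k x) x, ⟨?_, fun K hK => ⟨A K, hEq K hK⟩⟩, ?_⟩
  · have hfin : T.elements.Finite := T.finite_faces.subset fun _ h => h.1
    have : Finite T.elements := hfin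
    have hcov : closure Ω ⊆ ⋃ K : T.elements, cell (K : Finset (E d)) := fun x hx => by
      obtain ⟨K, hK, hx⟩ := T.exists_element hx
      exact Set.mem_iUnion.2 ⟨⟨K, hK⟩, hx⟩
    refine ContinuousOn.mono ?_ hcov
    refine (locallyFinite_of_finite _).continuousOn_iUnion
      (fun K => ((K : Finset (E d)).finite_toSet.isClosed_convexHull ℝ)) fun K => ?_
    exact ((A K).continuous_of_finiteDimensional.continuousOn).congr (hEq K K.2)
  · intro z hz
    have hz' : z ∈ closure Ω := by
      rw [← T.space_eq]; exact Geometry.SimplicialComplex.vertices_subset_space hz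
    obtain ⟨hk1, hk2⟩ := hk z hz'
    exact hA _ hk1 z ((Geometry.SimplicialComplex.vertex_mem_convexHull_iff hz hk1.1).1 hk2)

/-- The nodal interpolant `I_h[f] ∈ V_h` of `f`. -/
def interp (f : E d → ℝ) : E d → ℝ := (T.exists_interpolant f).choose

theorem interp_mem (f : E d → ℝ) : T.interp f ∈ T.Vh := (T.exists_interpolant f).choose_spec.1

theorem interp_apply (f : E d → ℝ) {z : E d} (hz : z ∈ T.nodes) : T.interp f z = f z :=
  (T.exists_interpolant f).choose_spec.2 z hz

end Mesh

variable {d : ℕ}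

/-- The gradient matrix `(∇n)_{ij} = ∂_j n_i` of a vector field. -/
def Grad (n : E d → E d) (x : E d) : Matrix (Fin d) (Fin d) ℝ :=
  Matrix.of fun i j => gradient (fun y => n y i) x j

/-- The matrix `n ⊗ ∇s` with entries `n_i ∂_j s`. -/
def outer (n : E d → E d) (s : E d → ℝ) (x : E d) : Matrix (Fin d) (Fin d) ℝ :=
  Matrix.of fun i j => n x i * gradient s x j

/-- The Frobenius inner product of matrices. -/
def frob (A B : Matrix (Fin d) (Fin d) ℝ) : ℝ := ∑ i, ∑ j, A i j * B i j

/-- The `L²` inner product of vector fields, also the `L²`-metric. -/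
def l2Metric (Ω : Set (E d)) (φ χ : E d → E d) : ℝ := ∫ x in Ω, inner ℝ (φ x) (χ x)

/-- The weighted `H¹`-metric `(h^α ∇φ, ∇χ)`. -/
def h1Metric (Ω : Set (E d)) (h α : ℝ) (φ χ : E d → E d) : ℝ :=
  ∫ x in Ω, h ^ α * frob (Grad φ x) (Grad χ x)

/-- `m` is a scalar product on `𝐕_{h,D}` (functions being identified if they agree on the closure
of `Ω`). -/
structure IsScalarProduct {Ω : Set (E d)} (T : Mesh Ω) (Γ : Set (E d))
    (m : (E d → E d) → (E d → E d) → ℝ) : Prop where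
  symm : ∀ φ ∈ T.VVhD Γ, ∀ χ ∈ T.VVhD Γ, m φ χ = m χ φ
  add_left : ∀ φ ∈ T.VVhD Γ, ∀ φ' ∈ T.VVhD Γ, ∀ χ ∈ T.VVhD Γ, m (φ + φ') χ = m φ χ + m φ' χ
  smul_left : ∀ (a : ℝ), ∀ φ ∈ T.VVhD Γ, ∀ χ ∈ T.VVhD Γ, m (a • φ) χ = a * m φ χ
  nonneg : ∀ φ ∈ T.VVhD Γ, 0 ≤ m φ φ
  definite : ∀ φ ∈ T.VVhD Γ, m φ φ = 0 → Set.EqOn φ 0 (closure Ω)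

/-- The data of the problem and of the algorithm: the elastic constant `κ`, time steps, tolerance,
the double-well potential with its convex splitting on an open interval `J`, the Dirichlet part of
the boundary and the Dirichlet data. -/
structure Setting (Ω : Set (E d)) where
  κ : ℝ
  τn : ℝ
  τs : ℝ
  tol : ℝ
  κ_pos : 0 < κ
  τn_pos : 0 < τn
  τs_pos : 0 < τs
  tol_pos : 0 < tol
  /-- the open interval on which the potential and its splitting are considered -/
  J : Set ℝ
  J_open : IsOpen J
  J_interval : J.OrdConnected
  ψ : ℝ → ℝ
  ψc : ℝ → ℝ
  ψe : ℝ → ℝ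
  ψ_smooth : ContDiffOn ℝ 2 ψ J
  ψ_nonneg : ∀ x ∈ J, 0 ≤ ψ x
  ψ_split : ∀ x ∈ J, ψ x = ψc x - ψe x
  ψc_quadratic : ∃ a b c : ℝ, ∀ x, ψc x = a * x ^ 2 + b * x + c
  ψc_convex : ConvexOn ℝ J ψc
  ψe_convex : ConvexOn ℝ J ψe
  ΓD : Set (E d)
  ΓD_subset : ΓD ⊆ frontier Ω
  g : E d → ℝ
  r : E d → E d
  g_pos : ∀ x ∈ ΓD, 0 < g x

namespace Setting

variable {Ω : Set (E d)} (P : Setting Ω)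

/-- The discrete elastic energy `E₁^h[s, n]`. -/
def E1 (s : E d → ℝ) (n : E d → E d) : ℝ :=
  1 / 2 * ∫ x in Ω, (P.κ * frob (outer n s x) (outer n s x)
    + s x ^ 2 * frob (Grad n x) (Grad n x))

/-- The discrete potential energy `E₂^h[s]`. -/
def E2 (s : E d → ℝ) : ℝ := ∫ x in Ω, P.ψ (s x)

/-- The discrete energy `E^h[s, n]`. -/
def energy (s : E d → ℝ) (n : E d → E d) : ℝ := P.E1 s n + P.E2 s

end Setting

/-- The first `N` outer iterations of the alternating direction discrete gradient flow with metric
`m`: degrees of orientation `s^0, …, s^N`, directors `n^0, …, n^N`, inner iterates `n^{i,ℓ}`,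
tangential updates `t^{i,ℓ}` and indices `ℓ_i` at which the inner loops stop. -/
structure Run {Ω : Set (E d)} (T : Mesh Ω) (P : Setting Ω)
    (m : (E d → E d) → (E d → E d) → ℝ) (N : ℕ) where
  s : ℕ → E d → ℝ
  n : ℕ → E d → E d
  /-- the inner iterates `n^{i,ℓ}` -/
  nn : ℕ → ℕ → E d → E d
  /-- the tangential updates `t^{i,ℓ}` -/
  t : ℕ → ℕ → E d → E d
  /-- the stopping indices `ℓ_i` -/
  last : ℕ → ℕ
  s_mem : ∀ i ≤ N, s i ∈ T.Vh
  n_mem : ∀ i ≤ N, n i ∈ T.VVh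
  nn_mem : ∀ i < N, ∀ ℓ ≤ last i + 1, nn i ℓ ∈ T.VVh
  /-- the values of `s^i` lie where the potential is defined -/
  s_range : ∀ i ≤ N, ∀ z ∈ T.nodes, s i z ∈ P.J
  n_init : ∀ z ∈ T.nodes, ‖n 0 z‖ = 1
  n_init_D : ∀ z ∈ T.nodes ∩ P.ΓD, n 0 z = (P.g z)⁻¹ • P.r z
  s_D : ∀ i ≤ N, ∀ z ∈ T.nodes ∩ P.ΓD, s i z = P.g z
  inner_start : ∀ i < N, Set.EqOn (nn i 0) (n i) (closure Ω)
  t_mem : ∀ i < N, ∀ ℓ ≤ last i, t i ℓ ∈ T.tangent P.ΓD (nn i ℓ)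
  t_eq : ∀ i < N, ∀ ℓ ≤ last i, ∀ φ ∈ T.tangent P.ΓD (nn i ℓ),
    m (t i ℓ) φ
      + P.τn * P.κ * (∫ x in Ω, frob (outer (t i ℓ) (s i) x) (outer φ (s i) x))
      + P.τn * (∫ x in Ω, frob (s i x • Grad (t i ℓ) x) (s i x • Grad φ x))
    = - P.κ * (∫ x in Ω, frob (outer (nn i ℓ) (s i) x) (outer φ (s i) x))
      - ∫ x in Ω, frob (s i x • Grad (nn i ℓ) x) (s i x • Grad φ x)
  nn_step : ∀ i < N, ∀ ℓ ≤ last i,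
    Set.EqOn (nn i (ℓ + 1)) (nn i ℓ + P.τn • t i ℓ) (closure Ω)
  last_crit : ∀ i < N, |P.E1 (s i) (nn i (last i + 1)) - P.E1 (s i) (nn i (last i))| < P.tol
  last_min : ∀ i < N, ∀ ℓ < last i,
    ¬ |P.E1 (s i) (nn i (ℓ + 1)) - P.E1 (s i) (nn i ℓ)| < P.tol
  n_next : ∀ i < N, Set.EqOn (n (i + 1)) (nn i (last i + 1)) (closure Ω)
  s_eq : ∀ i < N, ∀ w ∈ T.VhD P.ΓD,
    (∫ x in Ω, (s (i + 1) x - s i x) / P.τs * w x)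
      + P.κ * (∫ x in Ω, frob (outer (n (i + 1)) (s (i + 1)) x) (outer (n (i + 1)) w x))
      + (∫ x in Ω, frob (s (i + 1) x • Grad (n (i + 1)) x) (w x • Grad (n (i + 1)) x))
      + (∫ x in Ω, deriv P.ψc (s (i + 1) x) * w x)
    = ∫ x in Ω, deriv P.ψe (s i x) * w x

end

end Ericksen

open Ericksen

/-! Everything rests on one energy law and one nodal identity. Testing the tangential equation with
its own solution gives `E1(n + τ t) + τ m(t,t) ≤ E1(n)`, and the convex splitting makes the step in
`s` energy decreasing. As the energy is nonnegative, summing over all inner and outer steps bounds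
`τ Σ m(t,t)` by the initial energy, however many steps there were (`Run.sum_metric_le`). At a node
each update is orthogonal to the current director, so by Pythagoras `|n(z)|² - 1 = τ² Σ |t(z)|²`
(`Run.norm_sq_eq`). The energy law absorbs one factor `τ`; the other is the factor in the claim.

What remains is to bound nodal values of a discrete field by the metric. For (i) and the `L²` case
of (ii) this is the local inverse estimate `Mesh.volume_mul_norm_sq_le`, combined in (ii) with `|K|
≥ c h_K^d`.

For the `H¹` metric it is the discrete Sobolev inequality `Mesh.exists_discrete_sobolev`. On a
convex part of the domain a function is compared with its mean along segments from a point `z`.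
Dilations `t ≤ h_min` about `z` are handled by the pointwise inverse bound on the gradient. For
larger `t`, Cauchy–Schwarz and a change of variables give a bound of order `1/t`, whose integral is
the logarithm. The convex parts are the cells of one fixed reference mesh of `Ω`; connectedness adds
up their oscillations, and a zero at a Dirichlet node turns oscillation into size. -/

namespace Ericksen.Mesh

variable {d : ℕ} {Ω : Set (E d)} (T : Mesh Ω)

/-! ### Mesh geometry: the cells tile `Ω` up to null sets. -/

theorem finite_elements : T.elements.Finite := T.finite_faces.subset fun _ h => h.1

/-- The elements of the mesh as a finite set. -/
noncomputable def elems : Finset (Finset (E d)) := T.finite_elements.toFinset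

variable {T} in
@[simp] theorem mem_elems {K : Finset (E d)} : K ∈ T.elems ↔ K ∈ T.elements := by simp [elems]

theorem convex_cell (K : Finset (E d)) : Convex ℝ (cell K) := convex_convexHull ℝ _

theorem isCompact_cell (K : Finset (E d)) : IsCompact (cell K) :=
  K.finite_toSet.isCompact_convexHull ℝ

theorem isClosed_cell (K : Finset (E d)) : IsClosed (cell K) := (isCompact_cell K).isClosed

theorem measurableSet_cell (K : Finset (E d)) : MeasurableSet (cell K) :=
  (isClosed_cell K).measurableSet

theorem mem_cell {K : Finset (E d)} {z : E d} (hz : z ∈ K) : z ∈ cell K :=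
  subset_convexHull ℝ _ hz

theorem volume_cell_ne_top (K : Finset (E d)) : volume (cell K) ≠ ⊤ :=
  (isCompact_cell K).measure_lt_top.ne

theorem cell_subset {K : Finset (E d)} (hK : K ∈ T.elements) : cell K ⊆ closure Ω := by
  rw [← T.space_eq]
  exact Geometry.SimplicialComplex.convexHull_subset_space hK.1

theorem closure_eq : closure Ω = ⋃ K ∈ T.elems, cell K := by
  refine Set.Subset.antisymm (fun x hx => ?_) (Set.iUnion₂_subset fun K hK =>
    T.cell_subset (mem_elems.1 hK))
  obtain ⟨K, hK, hx⟩ := T.exists_element hx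
  exact Set.mem_biUnion (mem_elems.2 hK) hx

theorem mem_nodes_of_mem {K : Finset (E d)} (hK : K ∈ T.elements) {z : E d} (hz : z ∈ K) :
    z ∈ T.nodes :=
  T.down_closed hK.1 (by simpa using hz) (by simp)

theorem nodes_subset : T.nodes ⊆ closure Ω := by
  rw [← T.space_eq]; exact Geometry.SimplicialComplex.vertices_subset_space

theorem exists_element_of_mem_nodes {z : E d} (hz : z ∈ T.nodes) : ∃ K ∈ T.elements, z ∈ K := by
  obtain ⟨K, hK, h⟩ := T.exists_element (T.nodes_subset hz)
  exact ⟨K, hK, (Geometry.SimplicialComplex.vertex_mem_convexHull_iff hz hK.1).1 h⟩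

theorem nonempty_of_mem {K : Finset (E d)} (hK : K ∈ T.elements) : K.Nonempty :=
  T.nonempty_of_mem_faces hK.1

theorem elems_nonempty (h : Ω.Nonempty) : T.elems.Nonempty := by
  obtain ⟨x, hx⟩ := h
  obtain ⟨K, hK, -⟩ := T.exists_element (subset_closure hx)
  exact ⟨K, mem_elems.2 hK⟩

theorem affineSpan_eq_top {K : Finset (E d)} (hK : K ∈ T.elements) :
    affineSpan ℝ (K : Set (E d)) = ⊤ := by
  have ind := T.indep hK.1
  have htop := (ind.affineSpan_eq_top_iff_card_eq_finrank_add_one).2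
    (by simp [T.card_facet K hK])
  simpa using htop

theorem interior_cell_nonempty {K : Finset (E d)} (hK : K ∈ T.elements) :
    (interior (cell K)).Nonempty :=
  interior_convexHull_nonempty_iff_affineSpan_eq_top.2 (T.affineSpan_eq_top hK)

theorem volume_cell_pos {K : Finset (E d)} (hK : K ∈ T.elements) : 0 < volume (cell K) :=
  (isOpen_interior.measure_pos volume (T.interior_cell_nonempty hK)).trans_le
    (measure_mono interior_subset)

theorem volume_real_cell_pos {K : Finset (E d)} (hK : K ∈ T.elements) :
    0 < volume.real (cell K) :=
  ENNReal.toReal_pos (T.volume_cell_pos hK).ne' (volume_cell_ne_top K)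

theorem interior_cell_subset (hΩ : IsPlainDomain Ω) {K : Finset (E d)} (hK : K ∈ T.elements) :
    interior (cell K) ⊆ Ω := by
  conv_rhs => rw [← hΩ.interior_closure]
  exact interior_mono (T.cell_subset hK)

theorem ae_mem_interior_cell (K : Finset (E d)) :
    ∀ᵐ x ∂volume.restrict (cell K), x ∈ interior (cell K) := by
  rw [ae_restrict_iff' (measurableSet_cell K)]
  have h := (convex_cell K).addHaar_frontier volume
  filter_upwards [measure_eq_zero_iff_ae_notMem.1 h] with x hx hxK
  by_contra hxi
  exact hx ⟨subset_closure hxK, hxi⟩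

/-- The boundary of `Ω` is null: a point of the closure that avoids the frontiers of all cells is
interior to some cell, hence in `Ω`, and frontiers of convex sets are null. -/
theorem restrict_eq_restrict_closure (T : Mesh Ω) (hΩ : IsPlainDomain Ω) :
    volume.restrict Ω = volume.restrict (closure Ω) := by
  refine Measure.restrict_congr_set ?_
  refine (subset_closure.eventuallyLE).antisymm ?_
  have h : ∀ K ∈ T.elems, ∀ᵐ x, x ∉ frontier (cell K) := fun K _ =>
    measure_eq_zero_iff_ae_notMem.1 ((convex_cell K).addHaar_frontier volume)
  have h' := (Filter.eventually_all_finset T.elems).2 h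
  filter_upwards [h'] with x hx (hxc : x ∈ closure Ω)
  obtain ⟨K, hK, hxK⟩ := T.exists_element hxc
  refine T.interior_cell_subset hΩ hK ?_
  by_contra hxi
  exact hx K (mem_elems.2 hK) ⟨subset_closure hxK, hxi⟩

/-- Conformity puts the intersection in the hull of the common vertices. Distinct elements share at
most `d` of them, which span a proper affine subspace, and such a subspace is null. -/
theorem aedisjoint_cell {K L : Finset (E d)} (hK : K ∈ T.elements) (hL : L ∈ T.elements)
    (hne : K ≠ L) : AEDisjoint volume (cell K) (cell L) := by
  classical
  have hsub := T.inter_subset_convexHull hK.1 hL.1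
  refine measure_mono_null (hsub.trans (convexHull_subset_affineSpan _)) ?_
  refine Measure.addHaar_affineSubspace _ _ fun htop => ?_
  have hlt : K ∩ L ⊂ K := by
    refine Finset.inter_subset_left.ssubset_of_ne fun h => hne ?_
    exact (Geometry.SimplicialComplex.mem_facets.1 hK).2 L hL.1 (Finset.inter_eq_left.1 h)
  have hcard := Finset.card_lt_card hlt
  rw [T.card_facet K hK] at hcard
  rw [← Finset.coe_inter] at htop
  have hne' : ((K ∩ L : Finset (E d)) : Set (E d)).Nonempty := by
    rw [← affineSpan_nonempty ℝ, htop]; exact Set.univ_nonempty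
  have hr : Module.finrank ℝ (vectorSpan ℝ ((K ∩ L : Finset (E d)) : Set (E d))) = d := by
    rw [← direction_affineSpan, htop, AffineSubspace.direction_top]; simp
  obtain ⟨n, hn⟩ : ∃ n, (K ∩ L).card = n + 1 :=
    ⟨_, (Nat.succ_pred_eq_of_pos (Finset.card_pos.2 hne')).symm⟩
  have h2 := finrank_vectorSpan_image_finset_le ℝ (id : E d → E d) (K ∩ L) hn
  rw [Finset.coe_image, Set.image_id, hr] at h2
  omega

theorem restrict_eq_sum (hΩ : IsPlainDomain Ω) :
    volume.restrict Ω = ∑ K ∈ T.elems, volume.restrict (cell K) := by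
  rw [T.restrict_eq_restrict_closure hΩ]
  have h : closure Ω = ⋃ K : T.elems, cell (K : Finset (E d)) := by
    rw [T.closure_eq]; exact Set.biUnion_eq_iUnion _ _
  rw [h, Measure.restrict_iUnion_ae, Measure.sum_fintype]
  · exact Finset.sum_coe_sort T.elems fun K => volume.restrict (cell K)
  · intro K L hKL
    exact T.aedisjoint_cell (mem_elems.1 K.2) (mem_elems.1 L.2) fun h => hKL (Subtype.ext h)
  · exact fun K => (measurableSet_cell _).nullMeasurableSet

theorem ae_restrict_iff_cells (hΩ : IsPlainDomain Ω) {p : E d → Prop} :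
    (∀ᵐ x ∂volume.restrict Ω, p x) ↔
      ∀ K ∈ T.elements, ∀ᵐ x ∂volume.restrict (cell K), p x := by
  rw [T.restrict_eq_restrict_closure hΩ, T.closure_eq, ae_restrict_biUnion_finset_iff]
  simp

/-- Gradients of discrete functions are computed only inside cells; this makes identities proved
there sufficient under the integral. -/
theorem ae_mem_interior (hΩ : IsPlainDomain Ω) :
    ∀ᵐ x ∂volume.restrict Ω, ∃ K ∈ T.elements, x ∈ interior (cell K) := by
  rw [T.ae_restrict_iff_cells hΩ]
  intro K hK
  filter_upwards [ae_mem_interior_cell K] with x hx using ⟨K, hK, hx⟩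

theorem integrable_iff_cells (hΩ : IsPlainDomain Ω) {f : E d → ℝ} :
    Integrable f (volume.restrict Ω) ↔ ∀ K ∈ T.elements, IntegrableOn f (cell K) := by
  rw [T.restrict_eq_restrict_closure hΩ, T.closure_eq]
  change IntegrableOn _ _ _ ↔ _
  rw [integrableOn_finset_iUnion]
  simp

theorem integral_eq_sum (hΩ : IsPlainDomain Ω) {f : E d → ℝ}
    (hf : Integrable f (volume.restrict Ω)) :
    ∫ x in Ω, f x = ∑ K ∈ T.elems, ∫ x in cell K, f x := by
  conv_lhs => rw [T.restrict_eq_sum hΩ]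
  exact integral_finsetSum_measure fun K hK =>
    (T.integrable_iff_cells hΩ).1 hf K (mem_elems.1 hK)

theorem lintegral_eq_sum (hΩ : IsPlainDomain Ω) (f : E d → ENNReal) :
    ∫⁻ x in Ω, f x = ∑ K ∈ T.elems, ∫⁻ x in cell K, f x := by
  conv_lhs => rw [T.restrict_eq_sum hΩ]
  exact lintegral_finsetSum_measure _ _ _

theorem diamOf_pos (hd : 0 < d) {K : Finset (E d)} (hK : K ∈ T.elements) : 0 < diamOf K := by
  have hc : 1 < K.card := by rw [T.card_facet K hK]; omega
  obtain ⟨a, ha, b, hb, hab⟩ := Finset.one_lt_card.1 hc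
  exact (dist_pos.2 hab).trans_le
    (Metric.dist_le_diam_of_mem (isCompact_cell K).isBounded (mem_cell ha) (mem_cell hb))

theorem hMin_le {K : Finset (E d)} (hK : K ∈ T.elements) : T.hMin ≤ diamOf K :=
  csInf_le (T.finite_elements.image _).bddBelow ⟨K, hK, rfl⟩

theorem le_hMax {K : Finset (E d)} (hK : K ∈ T.elements) : diamOf K ≤ T.hMax :=
  le_csSup (T.finite_elements.image _).bddAbove ⟨K, hK, rfl⟩

theorem hMin_pos (hd : 0 < d) (h : Ω.Nonempty) : 0 < T.hMin := by
  obtain ⟨K, hK⟩ := T.elems_nonempty h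
  have hne : (diamOf '' T.elements).Nonempty := ⟨_, K, mem_elems.1 hK, rfl⟩
  obtain ⟨L, hL, h⟩ := hne.csInf_mem (T.finite_elements.image diamOf)
  rw [hMin, ← h]
  exact T.diamOf_pos hd hL

theorem hMin_le_hMax (h : Ω.Nonempty) : T.hMin ≤ T.hMax := by
  obtain ⟨K, hK⟩ := T.elems_nonempty h
  exact (T.hMin_le (mem_elems.1 hK)).trans (T.le_hMax (mem_elems.1 hK))

end Ericksen.Mesh

namespace Ericksen

variable {d : ℕ} {Ω : Set (E d)}

/-! ### Piecewise affine functions and integrability of the integrands. -/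

namespace Mesh

variable (T : Mesh Ω)

variable {T} in
theorem Vh_add {u v : E d → ℝ} (hu : u ∈ T.Vh) (hv : v ∈ T.Vh) : u + v ∈ T.Vh := by
  refine ⟨hu.1.add hv.1, fun K hK => ?_⟩
  obtain ⟨A, hA⟩ := hu.2 K hK
  obtain ⟨B, hB⟩ := hv.2 K hK
  exact ⟨A + B, fun x hx => by simp [hA hx, hB hx]⟩

variable {T} in
theorem Vh_smul (c : ℝ) {v : E d → ℝ} (hv : v ∈ T.Vh) : c • v ∈ T.Vh := by
  refine ⟨hv.1.const_smul c, fun K hK => ?_⟩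
  obtain ⟨B, hB⟩ := hv.2 K hK
  exact ⟨c • B, fun x hx => by simp [hB hx]⟩

variable {T} in
theorem Vh_sub {u v : E d → ℝ} (hu : u ∈ T.Vh) (hv : v ∈ T.Vh) : u - v ∈ T.Vh := by
  simpa [sub_eq_add_neg] using Vh_add hu (Vh_smul (-1) hv)

variable {T} in
/-- On an element, a function of `V_h` is determined by a constant gradient. -/
theorem Vh_exists_gradient {v : E d → ℝ} (hv : v ∈ T.Vh) {K : Finset (E d)}
    (hK : K ∈ T.elements) : ∃ g : E d,
      (∀ x ∈ cell K, ∀ y ∈ cell K, v y - v x = inner ℝ g (y - x)) ∧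
      ∀ x ∈ interior (cell K), HasGradientAt v g x := by
  obtain ⟨A, hA⟩ := hv.2 K hK
  let L : E d →L[ℝ] ℝ := A.linear.toContinuousLinearMap
  have hL : ∀ x y, A y - A x = L (y - x) := fun x y => (A.linearMap_vsub y x).symm
  refine ⟨(InnerProductSpace.toDual ℝ (E d)).symm L, fun x hx y hy => ?_, fun x hx => ?_⟩
  · rw [InnerProductSpace.toDual_symm_apply, hA hx, hA hy, hL]
  · rw [hasGradientAt_iff_hasFDerivAt, LinearIsometryEquiv.apply_symm_apply]
    have h1 : HasFDerivAt (fun y => L (y - x) + A x) L x :=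
      (L.hasFDerivAt.comp x ((hasFDerivAt_id x).sub_const x)).add_const (A x)
    refine h1.congr_of_eventuallyEq ?_
    filter_upwards [mem_interior_iff_mem_nhds.1 hx] with y hy
    rw [hA hy, ← hL x y]; ring

variable {T} in
theorem Vh_hasGradientAt {v : E d → ℝ} (hv : v ∈ T.Vh) {K : Finset (E d)}
    (hK : K ∈ T.elements) {x : E d} (hx : x ∈ interior (cell K)) :
    HasGradientAt v (gradient v x) x := by
  obtain ⟨g, -, h⟩ := Vh_exists_gradient hv hK
  exact (h x hx).differentiableAt.hasGradientAt

/-- Functions that agree in the interior of each element with a function that is continuous on the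
closed element. -/
def PwCont (f : E d → ℝ) : Prop :=
  ∀ K ∈ T.elements, ∃ g : E d → ℝ, ContinuousOn g (cell K) ∧ Set.EqOn f g (interior (cell K))

namespace PwCont

variable {T} {f g : E d → ℝ}

theorem add (hf : T.PwCont f) (hg : T.PwCont g) : T.PwCont fun x => f x + g x := by
  intro K hK
  obtain ⟨f', hf', h⟩ := hf K hK
  obtain ⟨g', hg', h'⟩ := hg K hK
  exact ⟨fun x => f' x + g' x, hf'.add hg', fun x hx => by simp only [h hx, h' hx]⟩

theorem mul (hf : T.PwCont f) (hg : T.PwCont g) : T.PwCont fun x => f x * g x := by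
  intro K hK
  obtain ⟨f', hf', h⟩ := hf K hK
  obtain ⟨g', hg', h'⟩ := hg K hK
  exact ⟨fun x => f' x * g' x, hf'.mul hg', fun x hx => by simp only [h hx, h' hx]⟩

theorem const (c : ℝ) : T.PwCont fun _ => c :=
  fun _ _ => ⟨fun _ => c, continuousOn_const, fun _ _ => rfl⟩

theorem sum {ι : Type*} (s : Finset ι) {F : ι → E d → ℝ} (h : ∀ i ∈ s, T.PwCont (F i)) :
    T.PwCont fun x => ∑ i ∈ s, F i x := by
  classical
  induction s using Finset.induction_on with
  | empty => simpa using const 0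
  | insert a s ha ih =>
    simp only [Finset.sum_insert ha]
    exact (h a (by simp)).add (ih fun i hi => h i (by simp [hi]))

theorem of_continuousOn (h : ContinuousOn f (closure Ω)) : T.PwCont f :=
  fun _ hK => ⟨f, h.mono (T.cell_subset hK), fun _ _ => rfl⟩

theorem integrable (hΩ : IsPlainDomain Ω) (hf : T.PwCont f) :
    Integrable f (volume.restrict Ω) := by
  rw [T.integrable_iff_cells hΩ]
  intro K hK
  obtain ⟨g, hg, h⟩ := hf K hK
  refine IntegrableOn.congr_fun_ae (hg.integrableOn_compact (isCompact_cell K)) ?_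
  filter_upwards [ae_mem_interior_cell K] with x hx using (h hx).symm

end PwCont

variable {T}

theorem Vh_pwCont {v : E d → ℝ} (hv : v ∈ T.Vh) : T.PwCont v := .of_continuousOn hv.1

/-- Values of `gradient` on faces, where it may be a default value, play no role: `PwCont` looks at
cell interiors only. -/
theorem Vh_pwCont_gradient {v : E d → ℝ} (hv : v ∈ T.Vh) (j : Fin d) :
    T.PwCont fun x => gradient v x j := by
  intro K hK
  obtain ⟨g, -, h⟩ := Vh_exists_gradient hv hK
  exact ⟨fun _ => g j, continuousOn_const, fun x hx => by simp only [(h x hx).gradient]⟩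

theorem VVh_smul (c : ℝ) {n : E d → E d} (hn : n ∈ T.VVh) : c • n ∈ T.VVh :=
  fun i => Vh_smul c (hn i)

theorem VVh_of_mem_VVhD {Γ : Set (E d)} {n : E d → E d} (hn : n ∈ T.VVhD Γ) : n ∈ T.VVh :=
  fun i => (hn i).1

theorem VVh_continuousOn {n : E d → E d} (hn : n ∈ T.VVh) : ContinuousOn n (closure Ω) := by
  have h : ContinuousOn (fun x => WithLp.ofLp (n x)) (closure Ω) :=
    continuousOn_pi.2 fun i => (hn i).1
  exact (PiLp.continuous_toLp 2 _).comp_continuousOn h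

theorem VVh_exists_affineMap {n : E d → E d} (hn : n ∈ T.VVh) {K : Finset (E d)}
    (hK : K ∈ T.elements) : ∃ A : E d →ᵃ[ℝ] E d, Set.EqOn n A (cell K) := by
  choose A hA using fun i => (hn i).2 K hK
  refine ⟨(WithLp.linearEquiv 2 ℝ (Fin d → ℝ)).symm.toLinearMap.toAffineMap.comp
    (AffineMap.pi A), fun x hx => ?_⟩
  ext i
  simpa using hA i hx

theorem pwCont_frob {A B : E d → Matrix (Fin d) (Fin d) ℝ}
    (hA : ∀ i j, T.PwCont fun x => A x i j) (hB : ∀ i j, T.PwCont fun x => B x i j) :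
    T.PwCont fun x => frob (A x) (B x) :=
  .sum _ fun i _ => .sum _ fun j _ => (hA i j).mul (hB i j)

theorem pwCont_outer {n : E d → E d} {s : E d → ℝ} (hn : n ∈ T.VVh) (hs : s ∈ T.Vh)
    (i j : Fin d) : T.PwCont fun x => outer n s x i j :=
  (Vh_pwCont (hn i)).mul (Vh_pwCont_gradient hs j)

theorem pwCont_Grad {n : E d → E d} (hn : n ∈ T.VVh) (i j : Fin d) :
    T.PwCont fun x => Grad n x i j :=
  Vh_pwCont_gradient (hn i) j

theorem pwCont_smul_Grad {n : E d → E d} {s : E d → ℝ} (hn : n ∈ T.VVh) (hs : s ∈ T.Vh)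
    (i j : Fin d) : T.PwCont fun x => (s x • Grad n x) i j :=
  (Vh_pwCont hs).mul (pwCont_Grad hn i j)

end Mesh

/-! ### Algebra of gradients, tensor products and the Frobenius product. -/

theorem gradient_congr {u v : E d → ℝ} (hΩ : IsOpen Ω) (h : Set.EqOn u v Ω) {x : E d}
    (hx : x ∈ Ω) : gradient u x = gradient v x := by
  unfold gradient
  rw [(h.eventuallyEq_of_mem (hΩ.mem_nhds hx)).fderiv_eq]

theorem Grad_congr {n n' : E d → E d} (hΩ : IsOpen Ω) (h : Set.EqOn n n' Ω) {x : E d}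
    (hx : x ∈ Ω) : Grad n x = Grad n' x := by
  ext i j
  simp only [Grad, Matrix.of_apply]
  rw [gradient_congr (v := fun y => n' y i) hΩ (fun y hy => by simp only [h hy]) hx]

theorem outer_add_left (n t : E d → E d) (s : E d → ℝ) (x : E d) :
    outer (n + t) s x = outer n s x + outer t s x := by
  ext i j; simp [outer, add_mul]

theorem outer_smul_left (c : ℝ) (n : E d → E d) (s : E d → ℝ) (x : E d) :
    outer (c • n) s x = c • outer n s x := by
  ext i j; simp [outer, mul_assoc]

theorem HasGradientAt.add' {u v : E d → ℝ} {a b x : E d} (hu : HasGradientAt u a x)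
    (hv : HasGradientAt v b x) : HasGradientAt (u + v) (a + b) x := by
  rw [hasGradientAt_iff_hasFDerivAt] at *
  rw [map_add]; exact hu.add hv

theorem HasGradientAt.smul' {u : E d → ℝ} {a x : E d} (c : ℝ) (hu : HasGradientAt u a x) :
    HasGradientAt (c • u) (c • a) x := by
  rw [hasGradientAt_iff_hasFDerivAt] at *
  have h := hu.const_smul c
  rwa [← LinearIsometryEquiv.map_smul] at h

namespace Mesh

variable {T : Mesh Ω}

theorem Grad_add {n t : E d → E d} (hn : n ∈ T.VVh) (ht : t ∈ T.VVh) {K : Finset (E d)}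
    (hK : K ∈ T.elements) {x : E d} (hx : x ∈ interior (cell K)) :
    Grad (n + t) x = Grad n x + Grad t x := by
  ext i j
  have h := ((Vh_hasGradientAt (hn i) hK hx).add' (Vh_hasGradientAt (ht i) hK hx)).gradient
  exact congrArg (fun w : E d => w j) h

theorem Grad_smul (c : ℝ) {n : E d → E d} (hn : n ∈ T.VVh) {K : Finset (E d)}
    (hK : K ∈ T.elements) {x : E d} (hx : x ∈ interior (cell K)) :
    Grad (c • n) x = c • Grad n x := by
  ext i j
  have h := ((Vh_hasGradientAt (hn i) hK hx).smul' c).gradient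
  exact congrArg (fun w : E d => w j) h

theorem outer_sub_right (n : E d → E d) {u v : E d → ℝ} (hu : u ∈ T.Vh) (hv : v ∈ T.Vh)
    {K : Finset (E d)} (hK : K ∈ T.elements) {x : E d} (hx : x ∈ interior (cell K)) :
    outer n (u - v) x = outer n u x - outer n v x := by
  have h := ((Vh_hasGradientAt hu hK hx).add' ((Vh_hasGradientAt hv hK hx).smul' (-1))).gradient
  ext i j
  have h' := congrArg (fun w : E d => w j) h
  have e : u + (-1 : ℝ) • v = u - v := by rw [neg_one_smul, sub_eq_add_neg]
  rw [e] at h'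
  simp only [outer, Matrix.of_apply, Matrix.sub_apply, h']
  simp
  ring

end Mesh

theorem frob_self_nonneg (A : Matrix (Fin d) (Fin d) ℝ) : 0 ≤ frob A A :=
  Finset.sum_nonneg fun _ _ => Finset.sum_nonneg fun _ _ => mul_self_nonneg _

theorem frob_add_smul_self (A B : Matrix (Fin d) (Fin d) ℝ) (c : ℝ) :
    frob (A + c • B) (A + c • B) = frob A A + 2 * c * frob A B + c ^ 2 * frob B B := by
  simp only [frob, Finset.mul_sum, ← Finset.sum_add_distrib]
  refine Finset.sum_congr rfl fun i _ => Finset.sum_congr rfl fun j _ => ?_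
  simp only [Matrix.add_apply, Matrix.smul_apply, smul_eq_mul]
  ring

theorem frob_smul_smul (A B : Matrix (Fin d) (Fin d) ℝ) (a b : ℝ) :
    frob (a • A) (b • B) = a * b * frob A B := by
  simp only [frob, Finset.mul_sum]
  refine Finset.sum_congr rfl fun i _ => Finset.sum_congr rfl fun j _ => ?_
  simp only [Matrix.smul_apply, smul_eq_mul]
  ring

/-- The gap between the two sides is `|A - B|² / 2`; this is convexity of half the squared norm. -/
theorem half_frob_sub_le (A B : Matrix (Fin d) (Fin d) ℝ) :
    1 / 2 * frob A A - 1 / 2 * frob B B ≤ frob A (A - B) := by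
  simp only [frob, Finset.mul_sum, ← Finset.sum_sub_distrib]
  refine Finset.sum_le_sum fun i _ => Finset.sum_le_sum fun j _ => ?_
  simp only [Matrix.sub_apply]
  nlinarith [sq_nonneg (A i j - B i j)]

/-! ### Energy estimates for a single step. -/

namespace Setting

variable (P : Setting Ω)

/-- The iterates of a `Run` are prescribed only on the closure of `Ω`. Equality on the open set `Ω`
is enough for gradients to agree there. -/
theorem E1_congr (hΩ : IsPlainDomain Ω) (s : E d → ℝ) {n n' : E d → E d}
    (h : Set.EqOn n n' (closure Ω)) : P.E1 s n = P.E1 s n' := by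
  have h' : Set.EqOn n n' Ω := h.mono subset_closure
  unfold E1
  congr 1
  refine setIntegral_congr_fun hΩ.isOpen.measurableSet fun x hx => ?_
  have h1 : outer n s x = outer n' s x := by ext i j; simp [outer, h' hx]
  simp only [h1, Grad_congr hΩ.isOpen h' hx]

/-- The elastic energy is quadratic in the director, so its second-order expansion is exact; the
linear term is what the right-hand side of the tangential equation contains. -/
theorem E1_add_smul {T : Mesh Ω} (hΩ : IsPlainDomain Ω) {s : E d → ℝ} {n t : E d → E d}
    (hs : s ∈ T.Vh) (hn : n ∈ T.VVh) (ht : t ∈ T.VVh) (c : ℝ) :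
    P.E1 s (n + c • t) = P.E1 s n
      + c * (P.κ * (∫ x in Ω, frob (outer n s x) (outer t s x))
        + ∫ x in Ω, frob (s x • Grad n x) (s x • Grad t x))
      + c ^ 2 / 2 * (P.κ * (∫ x in Ω, frob (outer t s x) (outer t s x))
        + ∫ x in Ω, frob (s x • Grad t x) (s x • Grad t x)) := by
  have i1 {a b : E d → E d} (ha : a ∈ T.VVh) (hb : b ∈ T.VVh) :
      Integrable (fun x => frob (outer a s x) (outer b s x)) (volume.restrict Ω) :=
    (Mesh.pwCont_frob (Mesh.pwCont_outer ha hs) (Mesh.pwCont_outer hb hs)).integrable hΩ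
  have i2 {a b : E d → E d} (ha : a ∈ T.VVh) (hb : b ∈ T.VVh) :
      Integrable (fun x => frob (s x • Grad a x) (s x • Grad b x)) (volume.restrict Ω) :=
    (Mesh.pwCont_frob (Mesh.pwCont_smul_Grad ha hs) (Mesh.pwCont_smul_Grad hb hs)).integrable hΩ
  have key : (∫ x in Ω, (P.κ * frob (outer (n + c • t) s x) (outer (n + c • t) s x)
      + s x ^ 2 * frob (Grad (n + c • t) x) (Grad (n + c • t) x)))
      = ∫ x in Ω, ((P.κ * frob (outer n s x) (outer n s x)
        + s x ^ 2 * frob (Grad n x) (Grad n x))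
        + ((2 * c) * (P.κ * frob (outer n s x) (outer t s x)
          + frob (s x • Grad n x) (s x • Grad t x))
        + c ^ 2 * (P.κ * frob (outer t s x) (outer t s x)
          + frob (s x • Grad t x) (s x • Grad t x)))) := by
    refine integral_congr_ae ?_
    filter_upwards [T.ae_mem_interior hΩ] with x hx
    obtain ⟨K, hK, hx⟩ := hx
    rw [outer_add_left, outer_smul_left, Mesh.Grad_add hn (Mesh.VVh_smul c ht) hK hx,
      Mesh.Grad_smul c ht hK hx]
    simp only [frob_add_smul_self, frob_smul_smul]
    ring
  have j1 {a b : E d → E d} (ha : a ∈ T.VVh) (hb : b ∈ T.VVh) := ((i1 ha hb).const_mul P.κ)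
  have j2 := (j1 hn ht).fun_add (i2 hn ht)
  have j3 := (j1 ht ht).fun_add (i2 ht ht)
  have j0 : Integrable (fun x => P.κ * frob (outer n s x) (outer n s x)
        + s x ^ 2 * frob (Grad n x) (Grad n x)) (volume.restrict Ω) := by
    refine ((j1 hn hn).add (i2 hn hn)).congr (Filter.Eventually.of_forall fun x => ?_)
    simp only [Pi.add_apply, frob_smul_smul]; ring
  unfold E1
  rw [key, integral_add j0 ((j2.const_mul _).fun_add (j3.const_mul _)),
    integral_add (j2.const_mul _) (j3.const_mul _), integral_const_mul, integral_const_mul,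
    integral_add (j1 hn ht) (i2 hn ht), integral_add (j1 ht ht) (i2 ht ht),
    integral_const_mul, integral_const_mul]
  ring

theorem E1_nonneg (s : E d → ℝ) (n : E d → E d) : 0 ≤ P.E1 s n :=
  mul_nonneg (by norm_num) <| integral_nonneg fun x =>
    add_nonneg (mul_nonneg P.κ_pos.le (frob_self_nonneg _))
      (mul_nonneg (sq_nonneg _) (frob_self_nonneg _))

end Setting

/-- An interval is convex and `s` is affine on each cell, so the nodal constraint passes to the
whole domain. -/
theorem mem_of_forall_nodes {T : Mesh Ω} {s : E d → ℝ} (hs : s ∈ T.Vh) {J : Set ℝ}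
    (hJ : J.OrdConnected) (h : ∀ z ∈ T.nodes, s z ∈ J) {x : E d} (hx : x ∈ closure Ω) :
    s x ∈ J := by
  obtain ⟨K, hK, hxK⟩ := T.exists_element hx
  obtain ⟨A, hA⟩ := hs.2 K hK
  have hconv : Convex ℝ (A ⁻¹' J) := hJ.convex.affine_preimage A
  have : Mesh.cell K ⊆ A ⁻¹' J := convexHull_min (fun z hz => by
    change A z ∈ J
    rw [← hA (Mesh.mem_cell hz)]
    exact h z (T.mem_nodes_of_mem hK hz)) hconv
  rw [hA hxK]
  exact this hxK

/-- Testing the energy of the director step with the tangential update. -/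
theorem E1_inner_step {T : Mesh Ω} (hΩ : IsPlainDomain Ω) (P : Setting Ω)
    {m : (E d → E d) → (E d → E d) → ℝ} {s : E d → ℝ} {n t : E d → E d}
    (hs : s ∈ T.Vh) (hn : n ∈ T.VVh) (ht : t ∈ T.VVh)
    (h : m t t + P.τn * P.κ * (∫ x in Ω, frob (outer t s x) (outer t s x))
      + P.τn * (∫ x in Ω, frob (s x • Grad t x) (s x • Grad t x))
      = - P.κ * (∫ x in Ω, frob (outer n s x) (outer t s x))
        - ∫ x in Ω, frob (s x • Grad n x) (s x • Grad t x)) :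
    P.E1 s (n + P.τn • t) + P.τn * m t t ≤ P.E1 s n := by
  rw [P.E1_add_smul hΩ hs hn ht]
  have h1 : 0 ≤ ∫ x in Ω, frob (outer t s x) (outer t s x) :=
    integral_nonneg fun x => frob_self_nonneg _
  have h2 : 0 ≤ ∫ x in Ω, frob (s x • Grad t x) (s x • Grad t x) :=
    integral_nonneg fun x => frob_self_nonneg _
  have h3 := mul_nonneg P.κ_pos.le h1
  have h4 := mul_nonneg (sq_nonneg P.τn) (add_nonneg h3 h2)
  -- With `Q` the quadratic form of `t`, the equation turns the linear term of the expansion into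
  -- `-τ m(t,t) - τ² Q`. The quadratic term is `τ² Q / 2`, so a nonpositive `-τ² Q / 2` is left over
  -- and dropped.
  have h5 : m t t = - P.κ * (∫ x in Ω, frob (outer n s x) (outer t s x))
        - (∫ x in Ω, frob (s x • Grad n x) (s x • Grad t x))
        - P.τn * P.κ * (∫ x in Ω, frob (outer t s x) (outer t s x))
      - P.τn * (∫ x in Ω, frob (s x • Grad t x) (s x • Grad t x)) := by linarith
  rw [h5]
  nlinarith [h4]

namespace Setting

variable (P : Setting Ω)

theorem hasDerivAt_ψc : ∃ a b : ℝ, ∀ x, HasDerivAt P.ψc (2 * a * x + b) x := by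
  obtain ⟨a, b, c, h⟩ := P.ψc_quadratic
  refine ⟨a, b, fun x => ?_⟩
  have e : P.ψc = fun x => a * x ^ 2 + b * x + c := funext h
  rw [e]
  have := (((hasDerivAt_pow 2 x).const_mul a).add ((hasDerivAt_id x).const_mul b)).add_const c
  refine this.congr_deriv ?_
  push_cast
  ring

theorem continuous_deriv_ψc : Continuous (deriv P.ψc) := by
  obtain ⟨a, b, h⟩ := P.hasDerivAt_ψc
  rw [funext fun x => (h x).deriv]
  fun_prop

theorem differentiableAt_ψc (x : ℝ) : DifferentiableAt ℝ P.ψc x := by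
  obtain ⟨a, b, h⟩ := P.hasDerivAt_ψc
  exact (h x).differentiableAt

/-- Differentiability of `ψe` is not assumed; it is inherited from `ψc - ψ`, with which `ψe` agrees
near each point of the open set `J`. -/
theorem hasDerivAt_ψe {x : ℝ} (hx : x ∈ P.J) :
    HasDerivAt P.ψe (deriv P.ψc x - deriv P.ψ x) x := by
  have h1 : DifferentiableAt ℝ P.ψ x :=
    (P.ψ_smooth.differentiableOn (by norm_num)).differentiableAt (P.J_open.mem_nhds hx)
  refine ((P.differentiableAt_ψc x).hasDerivAt.sub h1.hasDerivAt).congr_of_eventuallyEq ?_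
  filter_upwards [P.J_open.mem_nhds hx] with y hy
  have := P.ψ_split y hy
  simp only [Pi.sub_apply]
  linarith

theorem continuousOn_deriv_ψe : ContinuousOn (deriv P.ψe) P.J := by
  have h : ContinuousOn (fun x => deriv P.ψc x - deriv P.ψ x) P.J :=
    P.continuous_deriv_ψc.continuousOn.sub
      (P.ψ_smooth.continuousOn_deriv_of_isOpen P.J_open (by norm_num))
  exact h.congr fun x hx => (P.hasDerivAt_ψe hx).deriv

/-- Convexity is used at two different points: the tangent of `ψc` at the new value `x` and the
tangent of `ψe` at the old value `y`. This matches the implicit-explicit treatment in the scheme. -/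
theorem ψ_sub_le {x y : ℝ} (hx : x ∈ P.J) (hy : y ∈ P.J) :
    P.ψ x - P.ψ y ≤ (deriv P.ψc x - deriv P.ψe y) * (x - y) := by
  have tangent {f : ℝ → ℝ} (hf : ConvexOn ℝ P.J f) {a b : ℝ} (ha : a ∈ P.J) (hb : b ∈ P.J)
      (hd : DifferentiableAt ℝ f a) : f a + deriv f a * (b - a) ≤ f b := by
    rcases lt_trichotomy a b with hab | hab | hab
    · have := hf.deriv_le_slope ha hb hab hd
      rw [slope_def_field, le_div_iff₀ (sub_pos.2 hab)] at this
      linarith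
    · simp [hab]
    · have := hf.slope_le_deriv hb ha hab hd
      rw [slope_def_field, div_le_iff₀ (sub_pos.2 hab)] at this
      linarith
  have h1 := tangent P.ψc_convex hx hy (P.differentiableAt_ψc x)
  have h2 := tangent P.ψe_convex hy hx (P.hasDerivAt_ψe hy).differentiableAt
  rw [P.ψ_split x hx, P.ψ_split y hy]
  linarith

theorem E2_nonneg {T : Mesh Ω} (hΩ : IsPlainDomain Ω) {s : E d → ℝ} (hs : s ∈ T.Vh)
    (h : ∀ z ∈ T.nodes, s z ∈ P.J) : 0 ≤ P.E2 s :=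
  setIntegral_nonneg hΩ.isOpen.measurableSet fun _ hx =>
    P.ψ_nonneg _ (mem_of_forall_nodes hs P.J_interval h (subset_closure hx))

end Setting

/-- The step in the degree of orientation does not increase the energy. -/
theorem energy_outer_step {T : Mesh Ω} (hΩ : IsPlainDomain Ω) (P : Setting Ω)
    {s s' : E d → ℝ} {n : E d → E d} (hs : s ∈ T.Vh) (hs' : s' ∈ T.Vh) (hn : n ∈ T.VVh)
    (hJ : ∀ z ∈ T.nodes, s z ∈ P.J) (hJ' : ∀ z ∈ T.nodes, s' z ∈ P.J)
    (h : (∫ x in Ω, (s' x - s x) / P.τs * (s' - s) x)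
      + P.κ * (∫ x in Ω, frob (outer n s' x) (outer n (s' - s) x))
      + (∫ x in Ω, frob (s' x • Grad n x) ((s' - s) x • Grad n x))
      + (∫ x in Ω, deriv P.ψc (s' x) * (s' - s) x)
      = ∫ x in Ω, deriv P.ψe (s x) * (s' - s) x) :
    P.energy s' n ≤ P.energy s n := by
  have hw : s' - s ∈ T.Vh := Mesh.Vh_sub hs' hs
  have hsJ := fun x hx => mem_of_forall_nodes hs P.J_interval hJ (x := x) hx
  have hsJ' := fun x hx => mem_of_forall_nodes hs' P.J_interval hJ' (x := x) hx
  have iE {u : E d → ℝ} (hu : u ∈ T.Vh) : Integrable (fun x =>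
      P.κ * frob (outer n u x) (outer n u x) + u x ^ 2 * frob (Grad n x) (Grad n x))
      (volume.restrict Ω) := by
    simp only [sq]
    exact ((Mesh.PwCont.const _).mul
      (Mesh.pwCont_frob (Mesh.pwCont_outer hn hu) (Mesh.pwCont_outer hn hu))).add
      (((Mesh.Vh_pwCont hu).mul (Mesh.Vh_pwCont hu)).mul
        (Mesh.pwCont_frob (Mesh.pwCont_Grad hn) (Mesh.pwCont_Grad hn))) |>.integrable hΩ
  have iψ {u : E d → ℝ} (hu : u ∈ T.Vh) (huJ : ∀ x ∈ closure Ω, u x ∈ P.J) :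
      Integrable (fun x => P.ψ (u x)) (volume.restrict Ω) :=
    (Mesh.PwCont.of_continuousOn (T := T)
      (P.ψ_smooth.continuousOn.comp hu.1 huJ)).integrable hΩ
  have i1 : Integrable (fun x => frob (outer n s' x) (outer n (s' - s) x)) (volume.restrict Ω) :=
    (Mesh.pwCont_frob (Mesh.pwCont_outer hn hs') (Mesh.pwCont_outer hn hw)).integrable hΩ
  have i2 : Integrable (fun x => frob (s' x • Grad n x) ((s' - s) x • Grad n x))
      (volume.restrict Ω) :=
    (Mesh.pwCont_frob (Mesh.pwCont_smul_Grad hn hs') (Mesh.pwCont_smul_Grad hn hw)).integrable hΩ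
  have i3 : Integrable (fun x => deriv P.ψc (s' x) * (s' - s) x) (volume.restrict Ω) :=
    ((Mesh.PwCont.of_continuousOn (T := T) (P.continuous_deriv_ψc.comp_continuousOn hs'.1)).mul
      (Mesh.Vh_pwCont hw)).integrable hΩ
  have i4 : Integrable (fun x => deriv P.ψe (s x) * (s' - s) x) (volume.restrict Ω) :=
    ((Mesh.PwCont.of_continuousOn (T := T) (P.continuousOn_deriv_ψe.comp hs.1 hsJ)).mul
      (Mesh.Vh_pwCont hw)).integrable hΩ
  have i34 : Integrable (fun x => deriv P.ψc (s' x) * (s' - s) x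
      - deriv P.ψe (s x) * (s' - s) x) (volume.restrict Ω) := i3.sub i4
  have h0 : 0 ≤ ∫ x in Ω, (s' x - s x) / P.τs * (s' - s) x := by
    refine integral_nonneg fun x => ?_
    have : (s' x - s x) / P.τs * (s' - s) x = (s' x - s x) ^ 2 / P.τs := by
      simp only [Pi.sub_apply]; ring
    rw [this]
    exact div_nonneg (sq_nonneg _) P.τs_pos.le
  -- The energy difference is bounded pointwise by the terms of the equation tested with `s' - s`:
  -- each quadratic part by convexity, the potential by `ψ_sub_le`. The equation makes the integral
  -- of these terms equal to minus the nonnegative time-difference term `h0`.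
  have key : (∫ x in Ω, ((1 / 2 * (P.κ * frob (outer n s' x) (outer n s' x)
        + s' x ^ 2 * frob (Grad n x) (Grad n x)) + P.ψ (s' x))
      - (1 / 2 * (P.κ * frob (outer n s x) (outer n s x)
        + s x ^ 2 * frob (Grad n x) (Grad n x)) + P.ψ (s x))))
      ≤ ∫ x in Ω, ((P.κ * frob (outer n s' x) (outer n (s' - s) x)
        + frob (s' x • Grad n x) ((s' - s) x • Grad n x))
        + (deriv P.ψc (s' x) * (s' - s) x - deriv P.ψe (s x) * (s' - s) x)) := by
    refine integral_mono_ae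
      ((((iE hs').const_mul _).add (iψ hs' hsJ')).sub (((iE hs).const_mul _).add (iψ hs hsJ)))
      (((i1.const_mul _).add i2).add (i3.sub i4)) ?_
    filter_upwards [T.ae_mem_interior hΩ] with x hx
    obtain ⟨K, hK, hx⟩ := hx
    have hxc := T.cell_subset hK (interior_subset hx)
    have h1 := P.ψ_sub_le (hsJ' x hxc) (hsJ x hxc)
    have h2 := mul_le_mul_of_nonneg_left (half_frob_sub_le (outer n s' x) (outer n s x))
      P.κ_pos.le
    have h3 := frob_self_nonneg (Grad n x)
    have h4 := mul_nonneg (sq_nonneg (s' x - s x)) h3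
    rw [Mesh.outer_sub_right n hs' hs hK hx]
    simp only [frob_smul_smul, Pi.sub_apply]
    nlinarith
  rw [integral_sub (((iE hs').const_mul _).fun_add (iψ hs' hsJ'))
    (((iE hs).const_mul _).fun_add (iψ hs hsJ)),
    integral_add ((iE hs').const_mul _) (iψ hs' hsJ'),
    integral_add ((iE hs).const_mul _) (iψ hs hsJ),
    integral_add ((i1.const_mul _).fun_add i2) i34, integral_add (i1.const_mul _) i2,
    integral_sub i3 i4] at key
  simp only [integral_const_mul] at key
  simp only [Setting.energy, Setting.E1, Setting.E2]
  linarith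

/-! ### Summed energy law and growth of nodal lengths. -/

namespace Run

variable {T : Mesh Ω} {P : Setting Ω} {m : (E d → E d) → (E d → E d) → ℝ} {N : ℕ}
  (R : Run T P m N)

theorem t_mem_VVhD {i ℓ : ℕ} (hi : i < N) (hℓ : ℓ ≤ R.last i) : R.t i ℓ ∈ T.VVhD P.ΓD :=
  (R.t_mem i hi ℓ hℓ).1

/-- The energy law of one inner loop. -/
theorem E1_inner_loop (hΩ : IsPlainDomain Ω) {i : ℕ} (hi : i < N) {k : ℕ}
    (hk : k ≤ R.last i + 1) :
    P.E1 (R.s i) (R.nn i k) + P.τn * ∑ ℓ ∈ Finset.range k, m (R.t i ℓ) (R.t i ℓ)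
      ≤ P.E1 (R.s i) (R.n i) := by
  induction k with
  | zero => simp [P.E1_congr hΩ (R.s i) (R.inner_start i hi)]
  | succ k ih =>
    have hk' : k ≤ R.last i := by omega
    have h := E1_inner_step hΩ P (m := m) (R.s_mem i hi.le) (R.nn_mem i hi k (by omega))
      (Mesh.VVh_of_mem_VVhD (R.t_mem_VVhD hi hk')) (R.t_eq i hi k hk' _ (R.t_mem i hi k hk'))
    rw [P.E1_congr hΩ (R.s i) (R.nn_step i hi k hk'), Finset.sum_range_succ, mul_add]
    linarith [ih (by omega)]

/-- The energy law of the algorithm. -/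
theorem energy_law (hΩ : IsPlainDomain Ω) {k : ℕ} (hk : k ≤ N) :
    P.energy (R.s k) (R.n k) + P.τn * ∑ i ∈ Finset.range k,
        ∑ ℓ ∈ Finset.range (R.last i + 1), m (R.t i ℓ) (R.t i ℓ)
      ≤ P.energy (R.s 0) (R.n 0) := by
  induction k with
  | zero => simp
  | succ k ih =>
    have hk' : k < N := by omega
    have h1 := R.E1_inner_loop hΩ hk' le_rfl
    -- The increment is an admissible test function because both iterates take the value `g` at the
    -- Dirichlet nodes.
    have hw : R.s (k + 1) - R.s k ∈ T.VhD P.ΓD :=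
      ⟨Mesh.Vh_sub (R.s_mem _ hk) (R.s_mem _ hk'.le), fun z hz => by
        simp [R.s_D _ hk z hz, R.s_D _ hk'.le z hz]⟩
    have h2 := energy_outer_step hΩ P (R.s_mem _ hk'.le) (R.s_mem _ hk) (R.n_mem _ hk)
      (R.s_range _ hk'.le) (R.s_range _ hk) (R.s_eq k hk' _ hw)
    have h3 := P.E1_congr hΩ (R.s k) (R.n_next k hk')
    rw [Finset.sum_range_succ, mul_add]
    have h4 := ih hk'.le
    simp only [Setting.energy] at h2 h4 ⊢
    linarith

/-- The final energy is nonnegative and can be dropped. The bound involves neither `N` nor the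
stopping indices. -/
theorem sum_metric_le (hΩ : IsPlainDomain Ω) :
    P.τn * ∑ i ∈ Finset.range N, ∑ ℓ ∈ Finset.range (R.last i + 1), m (R.t i ℓ) (R.t i ℓ)
      ≤ P.energy (R.s 0) (R.n 0) := by
  have h := R.energy_law hΩ le_rfl
  have h1 := P.E1_nonneg (R.s N) (R.n N)
  have h2 := P.E2_nonneg hΩ (R.s_mem N le_rfl) (R.s_range N le_rfl)
  simp only [Setting.energy] at h ⊢
  linarith

/-- Pythagoras at a node: the tangential update is orthogonal to the current iterate there, so the
cross term vanishes. -/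
theorem norm_sq_inner_loop {z : E d} (hz : z ∈ T.nodes) {i : ℕ} (hi : i < N) {k : ℕ}
    (hk : k ≤ R.last i + 1) :
    ‖R.nn i k z‖ ^ 2 = ‖R.n i z‖ ^ 2 + P.τn ^ 2 * ∑ ℓ ∈ Finset.range k, ‖R.t i ℓ z‖ ^ 2 := by
  have hzc := T.nodes_subset hz
  induction k with
  | zero => simp [R.inner_start i hi hzc]
  | succ k ih =>
    have hk' : k ≤ R.last i := by omega
    rw [R.nn_step i hi k hk' hzc, Finset.sum_range_succ, mul_add, ← add_assoc, ← ih (by omega)]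
    simp only [Pi.add_apply, Pi.smul_apply]
    rw [norm_add_sq_real, inner_smul_right, (R.t_mem i hi k hk').2 z hz, norm_smul, mul_pow]
    simp

/-- The nodal values of the director field grow by the tangential updates only. -/
theorem norm_sq_eq {z : E d} (hz : z ∈ T.nodes) {k : ℕ} (hk : k ≤ N) :
    ‖R.n k z‖ ^ 2 = 1 + P.τn ^ 2 * ∑ i ∈ Finset.range k,
        ∑ ℓ ∈ Finset.range (R.last i + 1), ‖R.t i ℓ z‖ ^ 2 := by
  induction k with
  | zero => simp [R.n_init z hz]
  | succ k ih =>
    rw [R.n_next k (by omega) (T.nodes_subset hz), R.norm_sq_inner_loop hz (by omega) le_rfl,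
      ih (by omega), Finset.sum_range_succ _ k, mul_add, add_assoc]

end Run

/-! ### Inverse estimates on a single element. -/

namespace Mesh

variable {T : Mesh Ω}

theorem norm_affineMap_le {F : Type*} [NormedAddCommGroup F] [NormedSpace ℝ F]
    (A : E d →ᵃ[ℝ] F) {K : Finset (E d)} {B : ℝ} (h : ∀ z ∈ K, ‖A z‖ ≤ B) {x : E d}
    (hx : x ∈ cell K) : ‖A x‖ ≤ B := by
  have hconv : Convex ℝ (A ⁻¹' Metric.closedBall 0 B) :=
    (convex_closedBall (0 : F) B).affine_preimage A
  have hsub : cell K ⊆ A ⁻¹' Metric.closedBall 0 B :=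
    convexHull_min (fun z hz => by simpa using h z hz) hconv
  simpa using hsub hx

theorem VVh_norm_le {n : E d → E d} (hn : n ∈ T.VVh) {B : ℝ}
    (h : ∀ z ∈ T.nodes, ‖n z‖ ≤ B) {x : E d} (hx : x ∈ closure Ω) : ‖n x‖ ≤ B := by
  obtain ⟨K, hK, hxK⟩ := T.exists_element hx
  obtain ⟨A, hA⟩ := VVh_exists_affineMap hn hK
  rw [hA hxK]
  refine norm_affineMap_le A (fun z hz => ?_) hxK
  rw [← hA (mem_cell hz)]
  exact h z (T.mem_nodes_of_mem hK hz)

theorem Vh_abs_le_sum {v : E d → ℝ} (hv : v ∈ T.Vh) {K : Finset (E d)} (hK : K ∈ T.elements)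
    {x : E d} (hx : x ∈ cell K) : |v x| ≤ ∑ z ∈ K, |v z| := by
  obtain ⟨A, hA⟩ := hv.2 K hK
  rw [hA hx, ← Real.norm_eq_abs]
  refine norm_affineMap_le A (fun z hz => ?_) hx
  rw [← hA (mem_cell hz), Real.norm_eq_abs]
  exact Finset.single_le_sum (f := fun z => |v z|) (fun _ _ => abs_nonneg _) hz

theorem VVh_continuousOn_norm_sq {φ : E d → E d} (hφ : φ ∈ T.VVh) :
    ContinuousOn (fun x => ‖φ x‖ ^ 2) (closure Ω) :=
  (VVh_continuousOn hφ).norm.pow 2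

/-- Local inverse estimate: nodal values are controlled by the `L²` norm on the element. -/
theorem volume_mul_norm_sq_le {φ : E d → E d} (hφ : φ ∈ T.VVh) {K : Finset (E d)}
    (hK : K ∈ T.elements) {z : E d} (hz : z ∈ K) :
    volume.real (cell K) * ‖φ z‖ ^ 2 ≤ 4 ^ (d + 1) * ∫ x in cell K, ‖φ x‖ ^ 2 := by
  obtain ⟨z₀, hz₀, hmax⟩ := K.exists_max_image (fun z => ‖φ z‖) (T.nonempty_of_mem hK)
  obtain ⟨A, hA⟩ := VVh_exists_affineMap hφ hK
  set M := ‖φ z₀‖ with hM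
  have hle : ∀ x ∈ cell K, ‖A x‖ ≤ M := fun x hx =>
    norm_affineMap_le A (fun z hz => by rw [← hA (mem_cell hz)]; exact hmax z hz) hx
  -- Shrink the cell by `1/4` towards a vertex `z₀` of maximal norm `M`. On the image the field has
  -- norm at least `3M/4 - M/4 = M/2`. The volume ratio `4^(-d)` and the square of `1/2` give the
  -- constant `4^(d+1)`.
  let S := AffineMap.homothety z₀ (1 / 4 : ℝ) '' cell K
  have hSK : S ⊆ cell K := by
    rintro _ ⟨x, hx, rfl⟩
    rw [AffineMap.homothety_eq_lineMap]
    exact (convex_cell K).lineMap_mem (mem_cell hz₀) hx ⟨by norm_num, by norm_num⟩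
  have hS : ∀ y ∈ S, M ^ 2 / 4 ≤ ‖φ y‖ ^ 2 := by
    intro y hy
    have hyK := hSK hy
    obtain ⟨x, hx, rfl⟩ := hy
    have h1 : A (AffineMap.homothety z₀ (1 / 4 : ℝ) x)
        = (3 / 4 : ℝ) • A z₀ + (1 / 4 : ℝ) • A x := by
      rw [AffineMap.homothety_eq_lineMap, AffineMap.apply_lineMap, AffineMap.lineMap_apply_module]
      norm_num
    have h2 : M / 2 ≤ ‖φ (AffineMap.homothety z₀ (1 / 4 : ℝ) x)‖ := by
      rw [hA hyK, h1]
      have h3 := norm_sub_le_norm_add ((3 / 4 : ℝ) • A z₀) ((1 / 4 : ℝ) • A x)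
      rw [norm_smul, norm_smul, ← hA (mem_cell hz₀), ← hM] at h3
      have := hle x hx
      norm_num at h3
      rw [← hA (mem_cell hz₀)]
      linarith
    have h0 : 0 ≤ M / 2 := by positivity
    nlinarith
  have hvS : volume.real S = (1 / 4) ^ d * volume.real (cell K) := by
    simp only [S, measureReal_def, Measure.addHaar_image_homothety, ENNReal.toReal_mul]
    rw [ENNReal.toReal_ofReal (abs_nonneg _), abs_of_nonneg (by positivity)]
    simp
  have hSm : MeasurableSet S := by
    refine ((isCompact_cell K).image ?_).measurableSet
    exact (AffineMap.homothety z₀ (1 / 4 : ℝ)).continuous_of_finiteDimensional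
  have hint : IntegrableOn (fun x => ‖φ x‖ ^ 2) (cell K) :=
    ((VVh_continuousOn_norm_sq hφ).mono (T.cell_subset hK)).integrableOn_compact
      (isCompact_cell K)
  have hSfin : volume S ≠ ⊤ := measure_ne_top_of_subset hSK (volume_cell_ne_top K)
  have h1 : volume.real S * (M ^ 2 / 4) ≤ ∫ x in S, ‖φ x‖ ^ 2 := by
    have := setIntegral_mono_on (integrableOn_const hSfin) (hint.mono_set hSK) hSm hS
    simpa using this
  have h2 : ∫ x in S, ‖φ x‖ ^ 2 ≤ ∫ x in cell K, ‖φ x‖ ^ 2 :=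
    setIntegral_mono_set hint (Filter.Eventually.of_forall fun _ => sq_nonneg _)
      hSK.eventuallyLE
  have h3 : ‖φ z‖ ^ 2 ≤ M ^ 2 := pow_le_pow_left₀ (norm_nonneg _) (hmax z hz) 2
  calc volume.real (cell K) * ‖φ z‖ ^ 2 ≤ volume.real (cell K) * M ^ 2 := by gcongr
    _ = 4 ^ (d + 1) * (volume.real S * (M ^ 2 / 4)) := by
      rw [hvS, one_div, inv_pow]; field_simp; ring
    _ ≤ _ := by gcongr; exact h1.trans h2

theorem l2Metric_self (φ : E d → E d) : l2Metric Ω φ φ = ∫ x in Ω, ‖φ x‖ ^ 2 := by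
  simp [l2Metric]

theorem l2Metric_self_nonneg (φ : E d → E d) : 0 ≤ l2Metric Ω φ φ := by
  rw [l2Metric_self]; exact integral_nonneg fun _ => sq_nonneg _

theorem l2Metric_self_eq_sum (hΩ : IsPlainDomain Ω) {φ : E d → E d} (hφ : φ ∈ T.VVh) :
    l2Metric Ω φ φ = ∑ K ∈ T.elems, ∫ x in cell K, ‖φ x‖ ^ 2 := by
  rw [l2Metric_self]
  exact T.integral_eq_sum hΩ
    ((PwCont.of_continuousOn (T := T) (VVh_continuousOn_norm_sq hφ)).integrable hΩ)

/-- The volume of an element of a shape-regular mesh is comparable to `h_K ^ d`. -/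
theorem exists_volume_lower_bound (d : ℕ) (σ : ℝ) : ∃ c : ℝ, 0 < c ∧ ∀ (Ω : Set (E d))
    (T : Mesh Ω), T.ShapeRegular σ → ∀ K ∈ T.elements,
      c * diamOf K ^ d ≤ volume.real (cell K) := by
  have hb : 0 < volume.real (Metric.closedBall (0 : E d) 1) :=
    ENNReal.toReal_pos (Metric.measure_closedBall_pos volume _ one_pos).ne'
      measure_closedBall_lt_top.ne
  -- The factor `2|σ| + 1` dominates `2σ` and is positive for every real `σ`.
  refine ⟨volume.real (Metric.closedBall (0 : E d) 1) / (2 * |σ| + 1) ^ d, by positivity,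
    fun Ω T hT K hK => ?_⟩
  obtain ⟨c, r, hr, hsub, hdiam⟩ := hT K hK
  have h1 : diamOf K ≤ (2 * |σ| + 1) * r := by nlinarith [le_abs_self σ]
  have h2 : volume.real (Metric.closedBall c r) ≤ volume.real (cell K) :=
    measureReal_mono hsub (volume_cell_ne_top K)
  have h3 : volume.real (Metric.closedBall c r)
      = r ^ d * volume.real (Metric.closedBall (0 : E d) 1) := by
    simp only [measureReal_def, Measure.addHaar_closedBall' volume c hr.le, ENNReal.toReal_mul]
    rw [ENNReal.toReal_ofReal (by positivity)]
    simp
  have h4 : diamOf K ^ d ≤ ((2 * |σ| + 1) * r) ^ d :=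
    pow_le_pow_left₀ Metric.diam_nonneg h1 d
  rw [div_mul_eq_mul_div, div_le_iff₀ (by positivity)]
  rw [mul_pow] at h4
  calc _ ≤ volume.real (Metric.closedBall (0 : E d) 1) * ((2 * |σ| + 1) ^ d * r ^ d) := by gcongr
    _ = volume.real (Metric.closedBall c r) * (2 * |σ| + 1) ^ d := by rw [h3]; ring
    _ ≤ _ := by gcongr

end Mesh

/-! ### From metric bounds on the updates to bounds on the director. -/

namespace Run

variable {T : Mesh Ω} {P : Setting Ω} {m : (E d → E d) → (E d → E d) → ℝ} {N : ℕ}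
  (R : Run T P m N)

theorem energy_zero_nonneg (hΩ : IsPlainDomain Ω) : 0 ≤ P.energy (R.s 0) (R.n 0) :=
  add_nonneg (P.E1_nonneg _ _) (P.E2_nonneg hΩ (R.s_mem 0 (Nat.zero_le _))
    (R.s_range 0 (Nat.zero_le _)))

/-- The unit-length violation in `L¹`, if the metric controls the `L²` norm. -/
theorem eLpNorm_interp_le (hΩ : IsPlainDomain Ω) {C : ℝ}
    (hm : ∀ φ ∈ T.VVhD P.ΓD, l2Metric Ω φ φ ≤ C * m φ φ) (hC : 0 ≤ C) :
    eLpNorm (T.interp fun x => ‖R.n N x‖ ^ 2 - 1) 1 (volume.restrict Ω)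
      ≤ ENNReal.ofReal ((d + 1) * 4 ^ (d + 1) * C * P.τn * P.energy (R.s 0) (R.n 0)) := by
  set f : E d → ℝ := fun x => ‖R.n N x‖ ^ 2 - 1 with hf
  have hfz : ∀ z ∈ T.nodes, f z = P.τn ^ 2 * ∑ i ∈ Finset.range N,
      ∑ ℓ ∈ Finset.range (R.last i + 1), ‖R.t i ℓ z‖ ^ 2 := fun z hz => by
    simp only [hf]; rw [R.norm_sq_eq hz le_rfl]; ring
  have ht : ∀ i ∈ Finset.range N, ∀ ℓ ∈ Finset.range (R.last i + 1), R.t i ℓ ∈ T.VVhD P.ΓD :=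
    fun i hi ℓ hℓ => R.t_mem_VVhD (Finset.mem_range.1 hi)
      (Nat.lt_succ_iff.1 (Finset.mem_range.1 hℓ))
  have hcell : ∀ K ∈ T.elements, volume.real (Mesh.cell K) * ∑ z ∈ K, |T.interp f z|
      ≤ P.τn ^ 2 * ∑ i ∈ Finset.range N, ∑ ℓ ∈ Finset.range (R.last i + 1),
        ((d + 1) * 4 ^ (d + 1) * ∫ x in Mesh.cell K, ‖R.t i ℓ x‖ ^ 2) := by
    intro K hK
    have e : ∀ z ∈ K, |T.interp f z| = P.τn ^ 2 * ∑ i ∈ Finset.range N,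
        ∑ ℓ ∈ Finset.range (R.last i + 1), ‖R.t i ℓ z‖ ^ 2 := by
      intro z hz
      have hzn := T.mem_nodes_of_mem hK hz
      rw [T.interp_apply f hzn, hfz z hzn, abs_of_nonneg]
      exact mul_nonneg (sq_nonneg _) (Finset.sum_nonneg fun _ _ =>
        Finset.sum_nonneg fun _ _ => sq_nonneg _)
    rw [Finset.sum_congr rfl e, ← Finset.mul_sum, mul_left_comm]
    refine mul_le_mul_of_nonneg_left ?_ (sq_nonneg _)
    rw [Finset.sum_comm, Finset.mul_sum]
    refine Finset.sum_le_sum fun i hi => ?_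
    rw [Finset.sum_comm, Finset.mul_sum]
    refine Finset.sum_le_sum fun ℓ hℓ => ?_
    rw [Finset.mul_sum]
    have hle := Finset.sum_le_card_nsmul K
      (fun z => volume.real (Mesh.cell K) * ‖R.t i ℓ z‖ ^ 2) _ fun z hz =>
        Mesh.volume_mul_norm_sq_le (Mesh.VVh_of_mem_VVhD (ht i hi ℓ hℓ)) hK hz
    rw [T.card_facet K hK, nsmul_eq_mul] at hle
    push_cast at hle
    linarith
  have hsum : ∑ K ∈ T.elems, volume.real (Mesh.cell K) * ∑ z ∈ K, |T.interp f z|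
      ≤ (d + 1) * 4 ^ (d + 1) * C * P.τn * P.energy (R.s 0) (R.n 0) := by
    calc _ ≤ ∑ K ∈ T.elems, P.τn ^ 2 * ∑ i ∈ Finset.range N,
          ∑ ℓ ∈ Finset.range (R.last i + 1),
            ((d + 1) * 4 ^ (d + 1) * ∫ x in Mesh.cell K, ‖R.t i ℓ x‖ ^ 2) :=
          Finset.sum_le_sum fun K hK => hcell K (Mesh.mem_elems.1 hK)
      _ = P.τn ^ 2 * ((d + 1) * 4 ^ (d + 1)) * ∑ i ∈ Finset.range N,
          ∑ ℓ ∈ Finset.range (R.last i + 1), l2Metric Ω (R.t i ℓ) (R.t i ℓ) := by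
        rw [← Finset.mul_sum, Finset.sum_comm, mul_assoc]
        congr 1
        rw [Finset.mul_sum]
        refine Finset.sum_congr rfl fun i hi => ?_
        rw [Finset.sum_comm, Finset.mul_sum]
        refine Finset.sum_congr rfl fun ℓ hℓ => ?_
        rw [Mesh.l2Metric_self_eq_sum hΩ (Mesh.VVh_of_mem_VVhD (ht i hi ℓ hℓ)), Finset.mul_sum]
      _ ≤ P.τn ^ 2 * ((d + 1) * 4 ^ (d + 1)) * ∑ i ∈ Finset.range N,
          ∑ ℓ ∈ Finset.range (R.last i + 1), C * m (R.t i ℓ) (R.t i ℓ) := by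
        refine mul_le_mul_of_nonneg_left ?_ (by positivity)
        exact Finset.sum_le_sum fun i hi => Finset.sum_le_sum fun ℓ hℓ => hm _ (ht i hi ℓ hℓ)
      -- One of the two factors `τn` is spent on the energy law, the other stays in the bound.
      _ = (d + 1) * 4 ^ (d + 1) * C * P.τn * (P.τn * ∑ i ∈ Finset.range N,
          ∑ ℓ ∈ Finset.range (R.last i + 1), m (R.t i ℓ) (R.t i ℓ)) := by
        simp only [← Finset.mul_sum]; ring
      _ ≤ _ := mul_le_mul_of_nonneg_left (R.sum_metric_le hΩ)
        (mul_nonneg (by positivity) P.τn_pos.le)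
  rw [eLpNorm_one_eq_lintegral_enorm, T.lintegral_eq_sum hΩ]
  refine le_trans (Finset.sum_le_sum fun K hK => ?_) (le_trans (le_of_eq
    (ENNReal.ofReal_sum_of_nonneg fun K _ => mul_nonneg measureReal_nonneg
      (Finset.sum_nonneg fun z _ => abs_nonneg (T.interp f z))).symm) (ENNReal.ofReal_le_ofReal hsum))
  have hb : ∀ x ∈ Mesh.cell K, ‖T.interp f x‖ₑ ≤ ENNReal.ofReal (∑ z ∈ K, |T.interp f z|) :=
    fun x hx => by
      rw [Real.enorm_eq_ofReal_abs]
      exact ENNReal.ofReal_le_ofReal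
        (Mesh.Vh_abs_le_sum (T.interp_mem f) (Mesh.mem_elems.1 hK) hx)
  refine (setLIntegral_mono' (Mesh.measurableSet_cell K) hb).trans ?_
  rw [setLIntegral_const, ENNReal.ofReal_mul measureReal_nonneg, measureReal_def,
    ENNReal.ofReal_toReal (Mesh.volume_cell_ne_top K), mul_comm]

/-- The maximum norm of the director field, if the metric controls nodal values. -/
theorem eLpNorm_top_le (hΩ : IsPlainDomain Ω) {B X : ℝ}
    (hm : ∀ φ ∈ T.VVhD P.ΓD, ∀ z ∈ T.nodes, ‖φ z‖ ^ 2 ≤ B * m φ φ) (hB : 0 ≤ B)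
    (hX : P.τn * B ≤ X) :
    eLpNorm (R.n N) ⊤ (volume.restrict Ω)
      ≤ ENNReal.ofReal (1 + X * P.energy (R.s 0) (R.n 0)) := by
  have hE := R.energy_zero_nonneg hΩ
  have hX0 : 0 ≤ X := (mul_nonneg P.τn_pos.le hB).trans hX
  have hz : ∀ z ∈ T.nodes, ‖R.n N z‖ ≤ 1 + X * P.energy (R.s 0) (R.n 0) := by
    intro z hz
    have h1 : ∑ i ∈ Finset.range N, ∑ ℓ ∈ Finset.range (R.last i + 1), ‖R.t i ℓ z‖ ^ 2
        ≤ ∑ i ∈ Finset.range N, ∑ ℓ ∈ Finset.range (R.last i + 1),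
          B * m (R.t i ℓ) (R.t i ℓ) :=
      Finset.sum_le_sum fun i hi => Finset.sum_le_sum fun ℓ hℓ =>
        hm _ (R.t_mem_VVhD (Finset.mem_range.1 hi) (Nat.lt_succ_iff.1 (Finset.mem_range.1 hℓ))) z hz
    simp only [← Finset.mul_sum] at h1
    have h2 := R.sum_metric_le hΩ
    have h3 : ‖R.n N z‖ ^ 2 ≤ 1 + X * P.energy (R.s 0) (R.n 0) := by
      rw [R.norm_sq_eq hz le_rfl]
      have h4 := mul_le_mul_of_nonneg_left h1 (sq_nonneg P.τn)
      have h5 := mul_le_mul_of_nonneg_left h2 (mul_nonneg P.τn_pos.le hB)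
      have h6 := mul_le_mul_of_nonneg_right hX hE
      nlinarith
    -- From `‖n‖² ≤ 1 + Y` with `Y ≥ 0` follows `‖n‖ ≤ 1 + Y`, since `1 + Y ≤ (1 + Y)²`.
    have h7 := mul_nonneg hX0 hE
    nlinarith [norm_nonneg (R.n N z)]
  rw [eLpNorm_exponent_top]
  refine eLpNormEssSup_le_of_ae_bound ?_
  rw [ae_restrict_iff' hΩ.isOpen.measurableSet]
  exact Filter.Eventually.of_forall fun x hx =>
    Mesh.VVh_norm_le (R.n_mem N le_rfl) hz (subset_closure hx)

end Run

/-! ### Discrete Sobolev inequality. -/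

/-- Cauchy–Schwarz against the constant `1`, read off from `∫ (f - a)² ≥ 0` at the mean `a = I / M`;
the zero measure is treated apart. -/
theorem sq_integral_le_measure_mul {α : Type*} [MeasurableSpace α] {μ : Measure α}
    [IsFiniteMeasure μ] {f : α → ℝ} (hf : Integrable f μ)
    (hf2 : Integrable (fun x => f x ^ 2) μ) :
    (∫ x, f x ∂μ) ^ 2 ≤ μ.real Set.univ * ∫ x, f x ^ 2 ∂μ := by
  set M := μ.real Set.univ with hM
  set I := ∫ x, f x ∂μ
  have key : ∀ a : ℝ, 0 ≤ (∫ x, f x ^ 2 ∂μ) - 2 * a * I + a ^ 2 * M := by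
    intro a
    have h0 : 0 ≤ ∫ x, (f x - a) ^ 2 ∂μ := integral_nonneg fun _ => sq_nonneg _
    have e : ∀ x, (f x - a) ^ 2 = f x ^ 2 - 2 * a * f x + a ^ 2 := fun x => by ring
    simp only [e] at h0
    have i1 : Integrable (fun x => f x ^ 2 - 2 * a * f x) μ := hf2.sub (hf.const_mul _)
    rw [integral_add i1 (integrable_const _), integral_sub hf2 (hf.const_mul _),
      integral_const_mul, integral_const, smul_eq_mul] at h0
    linarith
  rcases (measureReal_nonneg (μ := μ) (s := Set.univ)).eq_or_lt with h | h
  · have hμ : μ = 0 := by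
      rw [← Measure.measure_univ_eq_zero]
      exact (measureReal_eq_zero_iff).1 h.symm
    simp [I, hμ]
  · have h1 := key (I / M)
    have hM0 : (0 : ℝ) < M := h
    have h2 := mul_nonneg hM0.le h1
    have e : M * ((∫ x, f x ^ 2 ∂μ) - 2 * (I / M) * I + (I / M) ^ 2 * M)
        = M * (∫ x, f x ^ 2 ∂μ) - I ^ 2 := by field_simp; ring
    linarith

namespace Mesh

variable (T : Mesh Ω)

/-- The square of an upper gradient of a piecewise affine function with gradients `g`. -/
noncomputable def gradSq (g : Finset (E d) → E d) (x : E d) : ℝ :=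
  ∑ K ∈ T.elems, (cell K).indicator (fun _ => ‖g K‖ ^ 2) x

theorem gradSq_nonneg (g : Finset (E d) → E d) (x : E d) : 0 ≤ T.gradSq g x :=
  Finset.sum_nonneg fun _ _ => Set.indicator_nonneg (fun _ _ => sq_nonneg _) _

theorem measurable_gradSq (g : Finset (E d) → E d) : Measurable (T.gradSq g) :=
  Finset.measurable_sum _ fun K _ => measurable_const.indicator (measurableSet_cell K)

theorem gradSq_le (g : Finset (E d) → E d) (x : E d) :
    T.gradSq g x ≤ ∑ K ∈ T.elems, ‖g K‖ ^ 2 :=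
  Finset.sum_le_sum fun _ _ => Set.indicator_le_self' (fun _ _ => sq_nonneg _) _

/-- Because `gradSq` sums over all cells containing `x`, the bound holds at every point. An
almost-everywhere bound would be useless on a segment lying inside a common face. -/
theorem norm_le_sqrt_gradSq (g : Finset (E d) → E d) {K : Finset (E d)} (hK : K ∈ T.elements)
    {x : E d} (hx : x ∈ cell K) : ‖g K‖ ≤ √(T.gradSq g x) := by
  refine Real.le_sqrt_of_sq_le ?_
  have h := Finset.single_le_sum (f := fun K => (cell K).indicator (fun _ => ‖g K‖ ^ 2) x)
    (fun _ _ => Set.indicator_nonneg (fun _ _ => sq_nonneg _) _) (mem_elems.2 hK)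
  simp only [Set.indicator_of_mem hx] at h
  exact h

theorem integrable_gradSq (g : Finset (E d) → E d) : Integrable (T.gradSq g) volume :=
  integrable_finsetSum _ fun K _ =>
    (integrable_indicator_iff (measurableSet_cell K)).2 (integrableOn_const (volume_cell_ne_top K))

theorem integral_gradSq (g : Finset (E d) → E d) :
    ∫ x, T.gradSq g x = ∑ K ∈ T.elems, volume.real (cell K) * ‖g K‖ ^ 2 := by
  unfold gradSq
  rw [integral_finsetSum _ fun K _ => (integrable_indicator_iff (measurableSet_cell K)).2
    (integrableOn_const (volume_cell_ne_top K))]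
  refine Finset.sum_congr rfl fun K _ => ?_
  rw [integral_indicator (measurableSet_cell K), setIntegral_const, smul_eq_mul]

variable {T} in
/-- `√gradSq` is an upper gradient along segments. -/
theorem sub_le_integral_segment {v : E d → ℝ} (hv : ContinuousOn v (closure Ω))
    {g : Finset (E d) → E d}
    (hg : ∀ K ∈ T.elements, ∀ x ∈ cell K, ∀ y ∈ cell K, v y - v x = inner ℝ (g K) (y - x))
    {x y : E d} (hxy : ∀ t ∈ Set.Icc (0 : ℝ) 1, x + t • (y - x) ∈ closure Ω) :
    v y - v x ≤ ∫ t in (0 : ℝ)..1, ‖y - x‖ * √(T.gradSq g (x + t • (y - x))) := by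
  set γ : ℝ → E d := fun t => x + t • (y - x) with hγ
  have hγc : Continuous γ := by fun_prop
  have hsub : ∀ t s, γ s - γ t = (s - t) • (y - x) := fun t s => by
    simp only [hγ, add_sub_add_left_eq_sub, sub_smul]
  -- Just after each time the segment stays in one cell for a while: among finitely many cells one
  -- is met at times arbitrarily close to `t` from the right. Closedness puts `γ t` in it, and
  -- convexity the whole piece. This yields a right derivative of `v` along the segment.
  have hcell : ∀ t ∈ Set.Ioo (0 : ℝ) 1, ∃ K ∈ T.elements, ∃ s > t,
      ∀ r ∈ Set.Icc t s, γ r ∈ cell K := by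
    intro t ht
    have h1 : ∃ᶠ s in nhdsWithin t (Set.Ioi t), ∃ K ∈ T.elems, γ s ∈ cell K := by
      refine Filter.Eventually.frequently ?_
      filter_upwards [Ioo_mem_nhdsGT ht.2] with s hs
      obtain ⟨K, hK, h⟩ := T.exists_element (hxy s ⟨ht.1.le.trans hs.1.le, hs.2.le⟩)
      exact ⟨K, mem_elems.2 hK, h⟩
    obtain ⟨K, hK, h2⟩ : ∃ K ∈ T.elems, ∃ᶠ s in nhdsWithin t (Set.Ioi t), γ s ∈ cell K := by
      by_contra! hcon
      refine h1 ?_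
      have := (Filter.eventually_all_finset T.elems).2 hcon
      filter_upwards [this] with s hs
      push Not
      exact hs
    have hcl : IsClosed (γ ⁻¹' cell K) := (isClosed_cell K).preimage hγc
    have htK : t ∈ γ ⁻¹' cell K := by
      rw [← hcl.closure_eq, mem_closure_iff_frequently]
      exact h2.filter_mono nhdsWithin_le_nhds
    obtain ⟨s, hsK, hts⟩ := (h2.and_eventually self_mem_nhdsWithin).exists
    refine ⟨K, mem_elems.1 hK, s, hts, fun r hr => ?_⟩
    have hconv : Convex ℝ (γ ⁻¹' cell K) := by
      have : γ = AffineMap.lineMap (k := ℝ) x y := by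
        ext1 t; simp [hγ, AffineMap.lineMap_apply, add_comm]
      rw [this]
      exact (convex_cell K).affine_preimage _
    exact hconv.ordConnected.out htK hsK hr
  choose! κ hκ s hs hκs using hcell
  have h := intervalIntegral.sub_le_integral_of_hasDeriv_right_of_le (g := fun t => v (γ t))
    (g' := fun t => inner ℝ (g (κ t)) (y - x))
    (φ := fun t => ‖y - x‖ * √(T.gradSq g (γ t))) zero_le_one
    (hv.comp hγc.continuousOn hxy) (fun t ht => ?_) ?_ (fun t ht => ?_)
  · simpa [hγ] using h
  · have hlin : HasDerivWithinAt (fun r => v (γ t) + (r - t) * inner ℝ (g (κ t)) (y - x))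
        (inner ℝ (g (κ t)) (y - x)) (Set.Ioi t) t := by
      have := (((hasDerivAt_id t).sub_const t).mul_const (inner ℝ (g (κ t)) (y - x))).const_add
        (v (γ t))
      simpa using this.hasDerivWithinAt
    have hst := hs t ht
    refine hlin.congr_of_eventuallyEq ?_ (by simp)
    filter_upwards [Ioo_mem_nhdsGT hst] with r hr
    have := hg (κ t) (hκ t ht) (γ t) (hκs t ht t ⟨le_rfl, hst.le⟩) (γ r)
      (hκs t ht r ⟨hr.1.le, hr.2.le⟩)
    rw [hsub, inner_smul_right] at this
    linarith
  · have hm : Measurable fun t => ‖y - x‖ * √(T.gradSq g (γ t)) :=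
      ((T.measurable_gradSq g).comp hγc.measurable).sqrt.const_mul _
    refine Measure.integrableOn_of_bounded (M := ‖y - x‖ * √(∑ K ∈ T.elems, ‖g K‖ ^ 2))
      (by simp) hm.aestronglyMeasurable (Filter.Eventually.of_forall fun t => ?_)
    rw [Real.norm_of_nonneg (by positivity)]
    gcongr
    exact T.gradSq_le g _
  · refine (real_inner_le_norm _ _).trans ?_
    rw [mul_comm]
    gcongr
    exact T.norm_le_sqrt_gradSq g (hκ t ht) (hκs t ht t ⟨le_rfl, (hs t ht).le⟩)

variable {T} in
theorem abs_sub_le_integral_segment {v : E d → ℝ} (hv : ContinuousOn v (closure Ω))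
    {g : Finset (E d) → E d}
    (hg : ∀ K ∈ T.elements, ∀ x ∈ cell K, ∀ y ∈ cell K, v y - v x = inner ℝ (g K) (y - x))
    {x y : E d} (hxy : ∀ t ∈ Set.Icc (0 : ℝ) 1, x + t • (y - x) ∈ closure Ω) :
    |v y - v x| ≤ ∫ t in (0 : ℝ)..1, ‖y - x‖ * √(T.gradSq g (x + t • (y - x))) := by
  refine abs_sub_le_iff.2 ⟨sub_le_integral_segment hv hg hxy, ?_⟩
  have h := sub_le_integral_segment (T := T) (v := fun x => - v x) (g := fun K => - g K) hv.neg
    (fun K hK x hx y hy => by rw [inner_neg_left, ← hg K hK x hx y hy]; ring) hxy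
  have e : T.gradSq (fun K => - g K) = T.gradSq g := by
    ext x; simp [gradSq]
  rw [e] at h
  linarith

theorem integral_gradSq_dilation (g : Finset (E d) → E d) (z : E d) {t : ℝ} (ht : 0 < t) :
    Integrable (fun y => T.gradSq g (z + t • (y - z))) volume ∧
    ∫ y, T.gradSq g (z + t • (y - z)) = (t ^ d)⁻¹ * ∫ x, T.gradSq g x := by
  have e : ∀ y, T.gradSq g (z + t • (y - z))
      = (fun u => T.gradSq g (u + (z - t • z))) (t • y) := fun y => by
    simp only [smul_sub]; congr 1; abel
  have hi : Integrable (fun u => T.gradSq g (u + (z - t • z))) volume :=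
    (T.integrable_gradSq g).comp_add_right _
  simp only [e]
  refine ⟨hi.comp_smul ht.ne', ?_⟩
  rw [Measure.integral_comp_smul volume (fun u => T.gradSq g (u + (z - t • z))),
    integral_add_right_eq_self (T.gradSq g)]
  simp [abs_of_pos ht]

/-- The average of the upper gradient over dilations of a convex set. -/
theorem integral_sqrt_gradSq_dilation_le (g : Finset (E d) → E d) {S : Set (E d)}
    (hS : volume S ≠ ⊤) (z : E d) {t : ℝ} (ht : 0 < t) :
    ∫ y in S, √(T.gradSq g (z + t • (y - z)))
      ≤ √(volume.real S * ((t ^ d)⁻¹ * ∫ x, T.gradSq g x)) := by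
  obtain ⟨hi, he⟩ := T.integral_gradSq_dilation g z ht
  have : IsFiniteMeasure (volume.restrict S) := ⟨by simpa using hS.lt_top⟩
  have hm : Measurable fun y => √(T.gradSq g (z + t • (y - z))) :=
    ((T.measurable_gradSq g).comp (by fun_prop)).sqrt
  have hsq : ∀ y, √(T.gradSq g (z + t • (y - z))) ^ 2 = T.gradSq g (z + t • (y - z)) :=
    fun y => Real.sq_sqrt (T.gradSq_nonneg g _)
  have h1 : Integrable (fun y => √(T.gradSq g (z + t • (y - z)))) (volume.restrict S) := by
    refine Integrable.of_bound hm.aestronglyMeasurable (√(∑ K ∈ T.elems, ‖g K‖ ^ 2))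
      (Filter.Eventually.of_forall fun y => ?_)
    rw [Real.norm_of_nonneg (Real.sqrt_nonneg _)]
    exact Real.sqrt_le_sqrt (T.gradSq_le g _)
  have h2 := sq_integral_le_measure_mul h1 (by simpa only [hsq] using hi.restrict)
  simp only [hsq, measureReal_restrict_apply_univ] at h2
  refine Real.le_sqrt_of_sq_le (h2.trans ?_)
  rw [← he]
  refine mul_le_mul_of_nonneg_left ?_ measureReal_nonneg
  exact setIntegral_le_integral hi (Filter.Eventually.of_forall fun _ => T.gradSq_nonneg g _)

/-- Integral over dilations: the small dilations are estimated by a pointwise bound `L`, the large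
ones by the `L²` norm. -/
theorem integral_integral_sqrt_gradSq_le (hd : 2 ≤ d) (g : Finset (E d) → E d) {S : Set (E d)}
    (hS : volume S ≠ ⊤) (z : E d) {ε L : ℝ} (hε : 0 < ε) (hε1 : ε ≤ 1)
    (hL : ∀ x, T.gradSq g x ≤ L) :
    ∫ y in S, ∫ t in (0 : ℝ)..1, √(T.gradSq g (z + t • (y - z)))
      ≤ ε * (volume.real S * √L)
        + √(volume.real S * ((ε ^ (d - 2))⁻¹ * ∫ x, T.gradSq g x)) * |Real.log ε| := by
  have : IsFiniteMeasure (volume.restrict S) := ⟨by simpa using hS.lt_top⟩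
  set F : E d → ℝ → ℝ := fun y t => √(T.gradSq g (z + t • (y - z))) with hF
  have hFm : Measurable (Function.uncurry F) := by
    refine ((T.measurable_gradSq g).comp ?_).sqrt
    exact Continuous.measurable (by fun_prop)
  have hF0 : ∀ y t, 0 ≤ F y t := fun _ _ => Real.sqrt_nonneg _
  have hFL : ∀ y t, F y t ≤ √L := fun _ _ => Real.sqrt_le_sqrt (hL _)
  have hFi : Integrable (Function.uncurry F)
      ((volume.restrict S).prod (volume.restrict (Set.Ioc (0 : ℝ) 1))) :=
    Integrable.of_bound hFm.aestronglyMeasurable (√L) (Filter.Eventually.of_forall fun p => by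
      exact (Real.norm_of_nonneg (hF0 p.1 p.2)).trans_le (hFL p.1 p.2))
  simp only [intervalIntegral.integral_of_le (zero_le_one' ℝ)]
  rw [integral_integral_swap hFi]
  set H : ℝ → ℝ := fun t => ∫ y in S, F y t with hH
  have hHi : IntegrableOn H (Set.Ioc 0 1) := hFi.integral_prod_right
  have hH1 : ∀ t, H t ≤ volume.real S * √L := by
    intro t
    have h := integral_mono_of_nonneg (μ := volume.restrict S)
      (Filter.Eventually.of_forall fun y => hF0 y t) (integrable_const (√L))
      (Filter.Eventually.of_forall fun y => hFL y t)
    simpa using h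
  set Q := √(volume.real S * ((ε ^ (d - 2))⁻¹ * ∫ x, T.gradSq g x)) with hQ
  have hD : 0 ≤ ∫ x, T.gradSq g x := integral_nonneg fun x => T.gradSq_nonneg g x
  -- For `t ≥ ε`, `t^(-d) ≤ ε^(-(d-2)) t^(-2)`. After the square root this is a multiple of `1/t`,
  -- which integrates to `|log ε|` over `[ε, 1]`.
  have hH2 : ∀ t, ε ≤ t → H t ≤ Q * t⁻¹ := by
    intro t ht
    have ht0 : 0 < t := hε.trans_le ht
    refine (T.integral_sqrt_gradSq_dilation_le g hS z ht0).trans ?_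
    have e : Q * t⁻¹ = √(volume.real S * ((ε ^ (d - 2))⁻¹ * ∫ x, T.gradSq g x) * (t⁻¹) ^ 2) := by
      rw [Real.sqrt_mul (by positivity), Real.sqrt_sq (by positivity)]
    rw [e]
    refine Real.sqrt_le_sqrt ?_
    have h1 : (t ^ d)⁻¹ ≤ (ε ^ (d - 2))⁻¹ * (t⁻¹) ^ 2 := by
      rw [inv_pow, ← mul_inv]
      refine inv_anti₀ (by positivity) ?_
      calc ε ^ (d - 2) * t ^ 2 ≤ t ^ (d - 2) * t ^ 2 := by gcongr
        _ = t ^ d := by rw [← pow_add]; congr 1; omega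
    calc volume.real S * ((t ^ d)⁻¹ * ∫ x, T.gradSq g x)
        ≤ volume.real S * (((ε ^ (d - 2))⁻¹ * (t⁻¹) ^ 2) * ∫ x, T.gradSq g x) := by gcongr
      _ = _ := by ring
  rw [← intervalIntegral.integral_of_le zero_le_one]
  have i1 : IntervalIntegrable H volume 0 ε :=
    (intervalIntegrable_iff_integrableOn_Ioc_of_le hε.le).2
      (hHi.mono_set (Set.Ioc_subset_Ioc_right hε1))
  have i2 : IntervalIntegrable H volume ε 1 :=
    (intervalIntegrable_iff_integrableOn_Ioc_of_le hε1).2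
      (hHi.mono_set (Set.Ioc_subset_Ioc_left hε.le))
  rw [← intervalIntegral.integral_add_adjacent_intervals i1 i2]
  refine add_le_add ?_ ?_
  · have h := intervalIntegral.integral_mono_on hε.le i1
      (intervalIntegrable_const (c := volume.real S * √L)) fun t _ => hH1 t
    rwa [intervalIntegral.integral_const, sub_zero, smul_eq_mul] at h
  · have i3 : IntervalIntegrable (fun t : ℝ => Q * t⁻¹) volume ε 1 := by
      refine ContinuousOn.intervalIntegrable ?_
      rw [Set.uIcc_of_le hε1]
      exact continuousOn_const.mul (continuousOn_id.inv₀ fun t ht => (hε.trans_le ht.1).ne')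
    have h := intervalIntegral.integral_mono_on hε1 i2 i3 fun t ht => hH2 t ht.1
    rw [intervalIntegral.integral_const_mul, integral_inv_of_pos hε one_pos] at h
    rwa [one_div, Real.log_inv, ← abs_of_nonpos (Real.log_nonpos hε.le hε1)] at h

end Mesh

namespace Mesh

variable {T : Mesh Ω}

/-- Oscillation of a piecewise affine function over a convex part of the domain. -/
theorem abs_sub_le_of_convex (hd : 2 ≤ d) {v : E d → ℝ} (hv : ContinuousOn v (closure Ω))
    {g : Finset (E d) → E d}
    (hg : ∀ K ∈ T.elements, ∀ x ∈ cell K, ∀ y ∈ cell K, v y - v x = inner ℝ (g K) (y - x))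
    {S : Set (E d)} (hSc : IsCompact S) (hSconv : Convex ℝ S) (hSΩ : S ⊆ closure Ω)
    (hS0 : 0 < volume.real S) {ε L : ℝ} (hε : 0 < ε) (hε1 : ε ≤ 1)
    (hL : ∀ x, T.gradSq g x ≤ L) {x y : E d} (hx : x ∈ S) (hy : y ∈ S) :
    |v y - v x| ≤ 2 * Metric.diam S * (ε * √L + (√(volume.real S))⁻¹
      * √((ε ^ (d - 2))⁻¹ * ∫ x, T.gradSq g x) * |Real.log ε|) := by
  have hSfin : volume S ≠ ⊤ := hSc.measure_lt_top.ne
  have hSm : MeasurableSet S := hSc.measurableSet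
  have : IsFiniteMeasure (volume.restrict S) := ⟨by simpa using hSfin.lt_top⟩
  have hvi : IntegrableOn v S := (hv.mono hSΩ).integrableOn_compact hSc
  set Q := √((ε ^ (d - 2))⁻¹ * ∫ x, T.gradSq g x) with hQ
  -- Comparison of `v z` with the mean over `S`: the segment bound is integrated over all endpoints
  -- `y`. Using it at both `x` and `y` produces the factor `2` in the claim.
  have key : ∀ z ∈ S, |(∫ y in S, v y) - volume.real S * v z| ≤ Metric.diam S *
      (ε * (volume.real S * √L) + √(volume.real S) * Q * |Real.log ε|) := by
    intro z hz
    have e : (∫ y in S, v y) - volume.real S * v z = ∫ y in S, (v y - v z) := by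
      rw [integral_sub hvi (integrable_const _)]; simp
    have h1 := T.integral_integral_sqrt_gradSq_le hd g hSfin z hε hε1 hL
    rw [Real.sqrt_mul measureReal_nonneg, ← hQ] at h1
    have hFm : Measurable (Function.uncurry fun (y : E d) (t : ℝ) =>
        √(T.gradSq g (z + t • (y - z)))) := by
      refine ((T.measurable_gradSq g).comp ?_).sqrt
      exact Continuous.measurable (by fun_prop)
    have hFi : Integrable (Function.uncurry fun (y : E d) (t : ℝ) =>
        √(T.gradSq g (z + t • (y - z))))
        ((volume.restrict S).prod (volume.restrict (Set.Ioc (0 : ℝ) 1))) :=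
      Integrable.of_bound hFm.aestronglyMeasurable (√L) (Filter.Eventually.of_forall fun p =>
        (Real.norm_of_nonneg (Real.sqrt_nonneg _)).trans_le (Real.sqrt_le_sqrt (hL _)))
    have hi : IntegrableOn (fun y => ∫ t in (0 : ℝ)..1, √(T.gradSq g (z + t • (y - z)))) S := by
      simp only [intervalIntegral.integral_of_le (zero_le_one' ℝ)]
      exact hFi.integral_prod_left
    rw [e]
    refine (abs_integral_le_integral_abs).trans ?_
    refine le_trans ?_ (mul_le_mul_of_nonneg_left h1 Metric.diam_nonneg)
    rw [← integral_const_mul]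
    refine setIntegral_mono_on (hvi.sub (integrable_const _)).abs (hi.const_mul _) hSm ?_
    intro y hy
    have hseg : ∀ t ∈ Set.Icc (0 : ℝ) 1, z + t • (y - z) ∈ closure Ω := fun t ht =>
      hSΩ (hSconv.add_smul_sub_mem hz hy ht)
    have h2 := abs_sub_le_integral_segment hv hg hseg
    rw [intervalIntegral.integral_const_mul] at h2
    refine h2.trans ?_
    have hdist : ‖y - z‖ ≤ Metric.diam S := by
      rw [← dist_eq_norm]; exact Metric.dist_le_diam_of_mem hSc.isBounded hy hz
    refine mul_le_mul_of_nonneg_right hdist ?_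
    exact intervalIntegral.integral_nonneg zero_le_one fun _ _ => Real.sqrt_nonneg _
  have hkx := key x hx
  have hky := key y hy
  have h3 : volume.real S * |v y - v x| ≤ 2 * (Metric.diam S *
      (ε * (volume.real S * √L) + √(volume.real S) * Q * |Real.log ε|)) := by
    rw [← abs_of_pos hS0, ← abs_mul, abs_of_pos hS0]
    have e : volume.real S * (v y - v x) = ((∫ y in S, v y) - volume.real S * v x)
      - ((∫ y in S, v y) - volume.real S * v y) := by ring
    rw [e]
    refine (abs_sub _ _).trans ?_
    linarith
  refine le_of_mul_le_mul_left (h3.trans (le_of_eq ?_)) hS0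
  have hw : volume.real S * (√(volume.real S))⁻¹ = √(volume.real S) := by
    rw [← div_eq_mul_inv, Real.div_sqrt]
  linear_combination (-(2 * Metric.diam S * Q * |Real.log ε|)) * hw

end Mesh

/-- A continuous function on a connected set covered by finitely many pieces oscillates at most by
the sum of the oscillations over the pieces. -/
theorem abs_sub_le_sum_of_isPreconnected {X ι : Type*} [TopologicalSpace X] {A : Set X}
    (hA : IsPreconnected A) {v : X → ℝ} (hv : ContinuousOn v A) (I : Finset ι) (S : ι → Set X)
    (hcov : A ⊆ ⋃ i ∈ I, S i) {δ : ι → ℝ} (hδ : ∀ i ∈ I, 0 ≤ δ i)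
    (hosc : ∀ i ∈ I, ∀ x ∈ S i, ∀ y ∈ S i, |v y - v x| ≤ δ i) {x y : X} (hx : x ∈ A)
    (hy : y ∈ A) : |v y - v x| ≤ ∑ i ∈ I, δ i := by
  -- Each `v '' S i` has length at most `δ i`. Their union contains the interval between `v x` and
  -- `v y`, as the image of a preconnected set is order connected. Subadditivity of Lebesgue measure
  -- replaces any chaining through neighbouring pieces.
  have hvol : ∀ i ∈ I, volume (v '' S i) ≤ ENNReal.ofReal (δ i) := by
    intro i hi
    refine (Real.volume_le_diam _).trans ?_
    refine Metric.ediam_le ?_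
    rintro _ ⟨a, ha, rfl⟩ _ ⟨b, hb, rfl⟩
    rw [edist_dist]
    exact ENNReal.ofReal_le_ofReal (hosc i hi b hb a ha)
  have hsub : Set.uIcc (v x) (v y) ⊆ ⋃ i ∈ I, v '' S i := by
    have h1 : (v '' A).OrdConnected := (hA.image v hv).ordConnected
    refine (h1.uIcc_subset ⟨x, hx, rfl⟩ ⟨y, hy, rfl⟩).trans ?_
    rintro _ ⟨a, ha, rfl⟩
    obtain ⟨i, hi, h⟩ := Set.mem_iUnion₂.1 (hcov ha)
    exact Set.mem_biUnion hi ⟨a, h, rfl⟩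
  have h := (measure_mono hsub).trans ((measure_biUnion_finset_le I _).trans
    (Finset.sum_le_sum hvol))
  rw [Real.volume_interval, ← ENNReal.ofReal_sum_of_nonneg hδ] at h
  exact (ENNReal.ofReal_le_ofReal_iff (Finset.sum_nonneg hδ)).1 h

namespace Mesh

/-- Discrete Sobolev inequality on a fixed domain: functions of `V_h` that vanish at one point. -/
theorem exists_discrete_sobolev (hd : 2 ≤ d) (hΩ : IsPlainDomain Ω) (σ : ℝ) {h₀ : ℝ}
    (h₀pos : 0 < h₀) (h₀lt : h₀ < 1) :
    ∃ C : ℝ, 0 < C ∧ ∀ T : Mesh Ω, T.ShapeRegular σ → T.hMin ≤ h₀ → ∀ v ∈ T.Vh,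
      ∀ z₀ ∈ closure Ω, v z₀ = 0 → ∀ x ∈ closure Ω,
        v x ^ 2 ≤ C * (Real.log T.hMin ^ 2 * (T.hMin ^ (d - 2))⁻¹
          * ∫ x in Ω, ‖gradient v x‖ ^ 2) := by
  -- An arbitrary fixed mesh `T₀` supplies the convex pieces, so the constant does not depend on
  -- `T`. Without any mesh the claim is vacuous.
  rcases isEmpty_or_nonempty (Mesh Ω) with hE | ⟨⟨T₀⟩⟩
  · exact ⟨1, one_pos, fun T => (hE.false T).elim⟩
  obtain ⟨c, hc, hvol⟩ := exists_volume_lower_bound d σ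
  have hlog₀ : 0 < |Real.log h₀| := abs_pos.2 (Real.log_neg h₀pos h₀lt).ne
  -- The small-dilation term carries no logarithm. The factor `|log h₀|⁻¹` lets it be absorbed
  -- through `1 ≤ |log h_min| / |log h₀|`, which needs `h₀ < 1`.
  set δ : Finset (E d) → ℝ := fun K =>
    2 * Metric.diam (cell K) * (|Real.log h₀|⁻¹ * √(c⁻¹) + (√(volume.real (cell K)))⁻¹) with hδ
  have hδ0 : ∀ K, 0 ≤ δ K := fun K => by
    have := Metric.diam_nonneg (s := cell K)
    positivity
  refine ⟨(∑ K ∈ T₀.elems, δ K) ^ 2 + 1, by positivity,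
    fun T hT hh v hv z₀ hz₀ hvz x hx => ?_⟩
  have hpos : 0 < T.hMin := T.hMin_pos (by omega) hΩ.isConnected.nonempty
  have hg' : ∀ K : Finset (E d), ∃ g : E d, K ∈ T.elements →
      (∀ x ∈ cell K, ∀ y ∈ cell K, v y - v x = inner ℝ g (y - x)) ∧
      ∀ x ∈ interior (cell K), HasGradientAt v g x := by
    intro K
    by_cases hK : K ∈ T.elements
    · obtain ⟨g, hg⟩ := Vh_exists_gradient hv hK
      exact ⟨g, fun _ => hg⟩
    · exact ⟨0, fun h => absurd h hK⟩
  choose g hg using hg'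
  set D := ∫ x, T.gradSq g x with hD
  have hDeq : ∫ x in Ω, ‖gradient v x‖ ^ 2 = D := by
    have hp : T.PwCont fun x => ‖gradient v x‖ ^ 2 := fun K hK =>
      ⟨fun _ => ‖g K‖ ^ 2, continuousOn_const, fun x hx => by
        simp only [((hg K hK).2 x hx).gradient]⟩
    rw [T.integral_eq_sum hΩ (hp.integrable hΩ), hD, T.integral_gradSq]
    refine Finset.sum_congr rfl fun K hK => ?_
    rw [← smul_eq_mul, ← setIntegral_const]
    refine setIntegral_congr_ae (measurableSet_cell K) ?_
    rw [← ae_restrict_iff' (measurableSet_cell K)]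
    filter_upwards [ae_mem_interior_cell K] with x hx
    rw [((hg K (mem_elems.1 hK)).2 x hx).gradient]
  have hD0 : 0 ≤ D := integral_nonneg fun x => T.gradSq_nonneg g x
  -- Inverse estimate for the constant gradients: every cell of `T` has volume at least `c h_min^d`.
  have hL : ∀ x, T.gradSq g x ≤ (c * T.hMin ^ d)⁻¹ * D := by
    intro x
    refine (T.gradSq_le g x).trans ?_
    rw [hD, T.integral_gradSq, Finset.mul_sum]
    refine Finset.sum_le_sum fun K hK => ?_
    have h1 : c * T.hMin ^ d ≤ volume.real (cell K) := by
      refine le_trans ?_ (hvol Ω T hT K (mem_elems.1 hK))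
      have := T.hMin_le (mem_elems.1 hK)
      gcongr
    rw [← mul_assoc, inv_mul_eq_div]
    refine le_mul_of_one_le_left (sq_nonneg _) ?_
    rwa [one_le_div (by positivity)]
  set β := |Real.log T.hMin| * √((T.hMin ^ (d - 2))⁻¹ * D) with hβ
  have hlog : |Real.log h₀| ≤ |Real.log T.hMin| := by
    rw [abs_of_neg (Real.log_neg h₀pos h₀lt),
      abs_of_neg (Real.log_neg hpos (hh.trans_lt h₀lt)), neg_le_neg_iff]
    exact Real.log_le_log hpos hh
  have hosc : ∀ K ∈ T₀.elems, ∀ x ∈ cell K, ∀ y ∈ cell K, |v y - v x| ≤ δ K * β := by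
    intro K hK x hx y hy
    have hK' := mem_elems.1 hK
    -- The cell is from `T₀`, the gradients are from `T`. Splitting at `ε = h_min` gives both
    -- contributions the same power `h_min^(-(d-2)/2)`.
    have h := abs_sub_le_of_convex hd hv.1 (fun K hK => (hg K hK).1) (isCompact_cell K)
      (convex_cell K) (T₀.cell_subset hK') (T₀.volume_real_cell_pos hK') hpos
      (hh.trans h₀lt.le) hL hx hy
    refine h.trans ?_
    have h1 : T.hMin * √((c * T.hMin ^ d)⁻¹ * D)
        = √(c⁻¹) * √((T.hMin ^ (d - 2))⁻¹ * D) := by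
      rw [← Real.sqrt_mul (by positivity)]
      conv_lhs => rw [← Real.sqrt_sq hpos.le, ← Real.sqrt_mul (by positivity)]
      congr 1
      have : T.hMin ^ d = T.hMin ^ (d - 2) * T.hMin ^ 2 := by
        rw [← pow_add]; congr 1; omega
      rw [Real.sqrt_sq hpos.le, this]
      field_simp
    have h2 : 1 ≤ |Real.log h₀|⁻¹ * |Real.log T.hMin| := by
      rwa [inv_mul_eq_div, one_le_div hlog₀]
    have h3 : √(c⁻¹) * √((T.hMin ^ (d - 2))⁻¹ * D) ≤ |Real.log h₀|⁻¹ * √(c⁻¹) * β := by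
      have := mul_le_mul_of_nonneg_right h2
        (show 0 ≤ √(c⁻¹) * √((T.hMin ^ (d - 2))⁻¹ * D) by positivity)
      rw [hβ]
      linarith
    rw [h1, ← hD, hδ]
    have hdiam := Metric.diam_nonneg (s := cell K)
    calc _ ≤ 2 * Metric.diam (cell K) * (|Real.log h₀|⁻¹ * √(c⁻¹) * β
          + (√(volume.real (cell K)))⁻¹ * β) := by
          refine mul_le_mul_of_nonneg_left (add_le_add h3 (le_of_eq ?_)) (by positivity)
          rw [hβ]; ring
      _ = _ := by ring
  have hfin := abs_sub_le_sum_of_isPreconnected hΩ.isConnected.isPreconnected.closure hv.1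
    T₀.elems cell T₀.closure_eq.subset (fun K _ => mul_nonneg (hδ0 K) (by positivity)) hosc hz₀ hx
  rw [hvz, sub_zero, ← Finset.sum_mul] at hfin
  have hsq : v x ^ 2 ≤ ((∑ K ∈ T₀.elems, δ K) * β) ^ 2 := by
    rw [← sq_abs]
    exact pow_le_pow_left₀ (abs_nonneg _) hfin 2
  have hβ2 : β ^ 2 = Real.log T.hMin ^ 2 * (T.hMin ^ (d - 2))⁻¹ * D := by
    rw [hβ, mul_pow, sq_abs, Real.sq_sqrt (by positivity)]; ring
  rw [hDeq, ← hβ2]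
  rw [mul_pow] at hsq
  nlinarith [sq_nonneg β]

end Mesh

/-! ### The weighted `H¹` metric and assembly of the result. -/

theorem frob_Grad_self (φ : E d → E d) (x : E d) :
    frob (Grad φ x) (Grad φ x) = ∑ i, ‖gradient (fun y => φ y i) x‖ ^ 2 := by
  simp only [frob, Grad, Matrix.of_apply, EuclideanSpace.norm_sq_eq, Real.norm_eq_abs, sq_abs]
  exact Finset.sum_congr rfl fun i _ => Finset.sum_congr rfl fun j _ => (sq _).symm

theorem Mesh.h1Metric_self {T : Mesh Ω} (hΩ : IsPlainDomain Ω) {φ : E d → E d} (hφ : φ ∈ T.VVh)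
    (h α : ℝ) : h1Metric Ω h α φ φ
      = h ^ α * ∑ i, ∫ x in Ω, ‖gradient (fun y => φ y i) x‖ ^ 2 := by
  unfold h1Metric
  rw [integral_const_mul]
  congr 1
  simp only [frob_Grad_self]
  refine integral_finsetSum _ fun i _ => ?_
  have h : T.PwCont fun x => ∑ j, gradient (fun y => φ y i) x j * gradient (fun y => φ y i) x j :=
    .sum _ fun j _ => (Vh_pwCont_gradient (hφ i) j).mul (Vh_pwCont_gradient (hφ i) j)
  simp only [EuclideanSpace.norm_sq_eq, Real.norm_eq_abs, sq_abs]
  simpa only [sq] using h.integrable hΩ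

end Ericksen

theorem proposition4p4 (d : ℕ) (hd : d = 2 ∨ d = 3) (σ : ℝ) :
    -- (i): control of the violation of the unit-length constraint
    (∀ Cstar : ℝ, 0 < Cstar → ∃ C₁ : ℝ, 0 < C₁ ∧
      ∀ (Ω : Set (E d)), IsPlainDomain Ω → ∀ (T : Mesh Ω), T.ShapeRegular σ →
      ∀ (P : Setting Ω) (m : (E d → E d) → (E d → E d) → ℝ), IsScalarProduct T P.ΓD m →
      (∀ φ ∈ T.VVhD P.ΓD, √(l2Metric Ω φ φ) ≤ Cstar * √(m φ φ)) →
      ∀ (j : ℕ), 1 ≤ j → ∀ (R : Run T P m j),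
        MeasureTheory.eLpNorm (T.interp fun x => ‖R.n j x‖ ^ 2 - 1) 1
            (MeasureTheory.volume.restrict Ω)
          ≤ ENNReal.ofReal (C₁ * P.τn * P.energy (R.s 0) (R.n 0))) ∧
    -- (ii), for the L²-metric
    (∃ c : ℝ, 0 < c ∧ ∀ (Ω : Set (E d)), IsPlainDomain Ω →
      ∀ (T : Mesh Ω), T.ShapeRegular σ → ∀ (P : Setting Ω) (Cstar : ℝ), 0 < Cstar →
      P.τn * T.hMin ^ (-(d : ℝ)) ≤ Cstar →
      ∀ (j : ℕ), 1 ≤ j → ∀ (R : Run T P (l2Metric Ω) j),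
        MeasureTheory.eLpNorm (R.n j) ⊤ (MeasureTheory.volume.restrict Ω)
          ≤ ENNReal.ofReal (1 + c * Cstar * P.energy (R.s 0) (R.n 0))) ∧
    -- (ii), for the weighted H¹-metric; Ω is fixed, and h_min stays away from 1
    (∀ (Ω : Set (E d)), IsPlainDomain Ω → ∀ h₀ : ℝ, 0 < h₀ → h₀ < 1 →
      ∃ c : ℝ, 0 < c ∧
      ∀ (T : Mesh Ω), T.ShapeRegular σ → T.hMin ≤ h₀ →
      ∀ (P : Setting Ω), (T.nodes ∩ P.ΓD).Nonempty →
      ∀ (α : ℝ), 0 < α → α ≤ 2 → ∀ (Cstar : ℝ), 0 < Cstar →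
      P.τn * T.hMin ^ (2 - (d : ℝ) - α) * |Real.log T.hMin| ^ 2 ≤ Cstar →
      ∀ (j : ℕ), 1 ≤ j → ∀ (R : Run T P (h1Metric Ω T.hMax α) j),
        MeasureTheory.eLpNorm (R.n j) ⊤ (MeasureTheory.volume.restrict Ω)
          ≤ ENNReal.ofReal (1 + c * Cstar * P.energy (R.s 0) (R.n 0))) := by
  have hd2 : 2 ≤ d := by omega
  refine ⟨fun Cstar hC => ?_, ?_, fun Ω hΩ h₀ h₀pos h₀lt => ?_⟩
  · refine ⟨(d + 1) * 4 ^ (d + 1) * Cstar ^ 2, by positivity,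
      fun Ω hΩ T _ P m hm hle j _ R => ?_⟩
    refine R.eLpNorm_interp_le hΩ (fun φ hφ => ?_) (sq_nonneg _)
    have h := pow_le_pow_left₀ (Real.sqrt_nonneg _) (hle φ hφ) 2
    rwa [mul_pow, Real.sq_sqrt (Mesh.l2Metric_self_nonneg φ), Real.sq_sqrt (hm.nonneg φ hφ)] at h
  · obtain ⟨c, hc, hvol⟩ := Mesh.exists_volume_lower_bound d σ
    refine ⟨4 ^ (d + 1) * c⁻¹, by positivity, fun Ω hΩ T hT P Cstar _ hτ j _ R => ?_⟩
    have hpos : 0 < T.hMin := T.hMin_pos (by omega) hΩ.isConnected.nonempty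
    rw [Real.rpow_neg hpos.le, Real.rpow_natCast] at hτ
    refine R.eLpNorm_top_le hΩ (B := 4 ^ (d + 1) * c⁻¹ * (T.hMin ^ d)⁻¹) (fun φ hφ z hz => ?_)
      (by positivity) ?_
    · obtain ⟨K, hK, hzK⟩ := T.exists_element_of_mem_nodes hz
      have hφ' := Mesh.VVh_of_mem_VVhD hφ
      have h1 := Mesh.volume_mul_norm_sq_le hφ' hK hzK
      have h2 : ∫ x in Mesh.cell K, ‖φ x‖ ^ 2 ≤ l2Metric Ω φ φ := by
        rw [Mesh.l2Metric_self_eq_sum hΩ hφ']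
        exact Finset.single_le_sum (f := fun K => ∫ x in Mesh.cell K, ‖φ x‖ ^ 2)
          (fun _ _ => integral_nonneg fun _ => sq_nonneg _) (Mesh.mem_elems.2 hK)
      have h3 : c * T.hMin ^ d ≤ volume.real (Mesh.cell K) := by
        refine le_trans ?_ (hvol Ω T hT K hK)
        have := T.hMin_le hK
        gcongr
      have h4 : c * T.hMin ^ d * ‖φ z‖ ^ 2 ≤ 4 ^ (d + 1) * l2Metric Ω φ φ :=
        (mul_le_mul_of_nonneg_right h3 (sq_nonneg _)).trans (h1.trans (by gcongr))
      have e : 4 ^ (d + 1) * c⁻¹ * (T.hMin ^ d)⁻¹ * l2Metric Ω φ φ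
          = 4 ^ (d + 1) * l2Metric Ω φ φ / (c * T.hMin ^ d) := by field_simp
      rw [e, le_div_iff₀ (by positivity), mul_comm]
      exact h4
    · calc _ = 4 ^ (d + 1) * c⁻¹ * (P.τn * (T.hMin ^ d)⁻¹) := by ring
        _ ≤ _ := by gcongr
  · obtain ⟨C, hC, hsob⟩ := Mesh.exists_discrete_sobolev hd2 hΩ σ h₀pos h₀lt
    refine ⟨C, hC, fun T hT hh P hne α hα _ Cstar _ hτ j _ R => ?_⟩
    obtain ⟨z₀, hz₀⟩ := hne
    have hpos : 0 < T.hMin := T.hMin_pos (by omega) hΩ.isConnected.nonempty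
    have hmax : T.hMin ≤ T.hMax := T.hMin_le_hMax hΩ.isConnected.nonempty
    have hMpos : 0 < T.hMax := hpos.trans_le hmax
    refine R.eLpNorm_top_le hΩ (B := C * (Real.log T.hMin ^ 2 * (T.hMin ^ (d - 2))⁻¹)
      * (T.hMax ^ α)⁻¹) (fun φ hφ z hz => ?_) (by positivity) ?_
    -- The scalar inequality is applied to each component, all of which vanish at `z₀`. Both sides
    -- are sums over components, so no factor `d` appears.
    · rw [Mesh.h1Metric_self hΩ (Mesh.VVh_of_mem_VVhD hφ), EuclideanSpace.norm_sq_eq, mul_assoc,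
        inv_mul_cancel_left₀ (by positivity), Finset.mul_sum]
      refine Finset.sum_le_sum fun i _ => ?_
      rw [Real.norm_eq_abs, sq_abs, mul_assoc C]
      exact hsob T hT hh _ (hφ i).1 z₀ (T.nodes_subset hz₀.1) ((hφ i).2 z₀ hz₀) z
        (T.nodes_subset hz)
    · have e : T.hMin ^ (2 - (d : ℝ) - α) = (T.hMin ^ (d - 2))⁻¹ * (T.hMin ^ α)⁻¹ := by
        rw [← Real.rpow_natCast, ← Real.rpow_neg hpos.le, ← Real.rpow_neg hpos.le,
          ← Real.rpow_add hpos, Nat.cast_sub hd2]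
        congr 1
        push_cast
        ring
      -- The metric is weighted by the maximal mesh size, the step restriction by the minimal one;
      -- `α > 0` makes the comparison go the right way.
      have hle : (T.hMax ^ α)⁻¹ ≤ (T.hMin ^ α)⁻¹ := by
        have := Real.rpow_le_rpow hpos.le hmax hα.le
        exact inv_anti₀ (by positivity) this
      rw [e, sq_abs] at hτ
      have hτn := P.τn_pos
      calc P.τn * (C * (Real.log T.hMin ^ 2 * (T.hMin ^ (d - 2))⁻¹) * (T.hMax ^ α)⁻¹)
          ≤ P.τn * (C * (Real.log T.hMin ^ 2 * (T.hMin ^ (d - 2))⁻¹) * (T.hMin ^ α)⁻¹) := by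
            gcongr
        _ = C * (P.τn * ((T.hMin ^ (d - 2))⁻¹ * (T.hMin ^ α)⁻¹) * Real.log T.hMin ^ 2) := by ring
        _ ≤ _ := by gcongr
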